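/- All maps are finite and may have loops and multiple edges; a planar map is a connected multigraph embedded in the oriented 2-sphere without crossing edges, up to orientation-preserving homeomorphism. Let $\mathcal{Q}^{(l)}$ be the set of quadrangulations $Q$ of the sphere (planar maps all of whose faces have degree $4$) with one marked unoriented edge (the root edge) and with integer labels on the vertices that differ by exactly one along every edge. Let $\mathcal{M}^{(l)}$ be the set of planar maps with one marked oriented edge (the root edge) and with integer labels on the vertices that differ by at most one along every edge. The root corner of $M\in\mathcal{M}^{(l)}$ is the corner, at the end point of the root edge, of the face directly on the left of the root edge; the label on the root is the label of the vertex at this corner. A vertex is a local minimum (maximum) if its label is at most (at least) the labels of all its neighbours. For $Q\in\mathcal{Q}^{(l)}$ draw one coloured edge in every face: in a face with labels $t+1,t,t-1,t$ in clockwise order, along the side joining the corner labeled $t+1$ to the next corner in clockwise order; in a face with labels $t+1,t,t+1,t$, along the diagonal joining the two corners labeled $t+1$. Each coloured edge is drawn inside its face. Let $\Psi(Q)$ be the embedded graph formed by the coloured edges and their end points, with the labels inherited from $Q$, and rooted at the corner containing the end with the larger label of the root edge of $Q$. Theorem 1. For every $Q\in\mathcal{Q}^{(l)}$ the graph $\Psi(Q)$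 is connected and $\Psi(Q)\in\mathcal{M}^{(l)}$; the map $\Psi:\mathcal{Q}^{(l)}\to\mathcal{M}^{(l)}$ is a bijection; and for every $Q\in\mathcal{Q}^{(l)}$: (i) the number of edges of $\Psi(Q)$ equals the number of faces of $Q$; (ii) the number of faces of $\Psi(Q)$ equals the number of local minima of $Q$; (iii) the number of local maxima of $\Psi(Q)$ equals the number of local maxima of $Q$; (iv) the maximal label of $\Psi(Q)$ equals the maximal label of $Q$; (v) the minimal label of $\Psi(Q)$ equals the minimal label of $Q$ plus one; (vi) the label on the root of $\Psi(Q)$ equals the larger of the two labels on the root edge of $Q$. -/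

import Mathlib

/-- A combinatorial map (rotation system): a finite set of darts (oriented edges), the permutation
`rot` turning a dart anticlockwise to the next dart with the same starting vertex, and the
fixed-point-free involution `rev` reversing the orientation of a dart.  It encodes a finite
multigraph, loops and multiple edges allowed, without isolated vertices, cellularly embedded in an
oriented closed surface (connected or not). -/
structure CombMap where
  Dart : Type
  [finite_dart : Finite Dart]
  rot : Equiv.Perm Dart
  rev : Equiv.Perm Dart
  rev_rev : ∀ d, rev (rev d) = d
  rev_ne : ∀ d, rev d ≠ d

namespace CombMap

instance (M : CombMap) : Finite M.Dart := M.finite_dart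

/-- The face permutation.  `M.next d` is the dart that follows `d` on the boundary of the face on
the right of `d`; this runs clockwise around that face.  The dart `d` also stands for a corner of
that face: the sector on the right of `d` at its starting vertex, between `M.rot.symm d` and `d`.
The corner that follows it clockwise around the face is `M.next d`. -/
def next (M : CombMap) : Equiv.Perm M.Dart := M.rev.trans M.rot

/-- Vertices: orbits of the rotation. -/
def Vertex (M : CombMap) : Type := Quotient (Equiv.Perm.SameCycle.setoid M.rot)

/-- Edges: orbits of the reversal. -/
def Edge (M : CombMap) : Type := Quotient (Equiv.Perm.SameCycle.setoid M.rev)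

/-- Faces: orbits of the face permutation. -/
def Face (M : CombMap) : Type := Quotient (Equiv.Perm.SameCycle.setoid M.next)

/-- The starting vertex of a dart. -/
def start (M : CombMap) (d : M.Dart) : M.Vertex :=
  Quotient.mk (Equiv.Perm.SameCycle.setoid M.rot) d

/-- The face on the right of a dart. -/
def rightFace (M : CombMap) (d : M.Dart) : M.Face :=
  Quotient.mk (Equiv.Perm.SameCycle.setoid M.next) d

/-- The degree of a face: its number of corners, equivalently the number of edges bounding it, an
edge with the face on both sides counted twice. -/
noncomputable def degree (M : CombMap) (f : M.Face) : ℕ :=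
  Nat.card {d : M.Dart // M.rightFace d = f}

/-- Any two darts are related by a sequence of rotations and reversals. -/
def IsConnected (M : CombMap) : Prop :=
  ∀ d e : M.Dart, ∃ g ∈ Subgroup.closure {M.rot, M.rev}, g d = e

/-- A connected embedded graph on the sphere: connected, with Euler characteristic
`V - E + F = 2`. -/
def IsPlanarMap (M : CombMap) : Prop :=
  M.IsConnected ∧ Nat.card M.Vertex + Nat.card M.Face = Nat.card M.Edge + 2

/-- All faces have degree four. -/
def IsQuadrangular (M : CombMap) : Prop := ∀ f : M.Face, M.degree f = 4

theorem next_four (M : CombMap) (h : M.IsQuadrangular) (d : M.Dart) :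
    M.next (M.next (M.next (M.next d))) = d := by
  classical
  have hc := h (M.rightFace d)
  have hp : Function.minimalPeriod (M.next • ·) d = 4 := by
    have : Fintype (MulAction.orbit (Subgroup.zpowers M.next) d) := Fintype.ofFinite _
    rw [MulAction.minimalPeriod_eq_card, ← Nat.card_eq_fintype_card, ← hc]
    refine Nat.card_congr (Equiv.subtypeEquivRight fun e => ?_)
    have hq : M.rightFace e = M.rightFace d ↔ M.next.SameCycle e d :=
      Quotient.eq (r := Equiv.Perm.SameCycle.setoid M.next)
    rw [hq, Equiv.Perm.sameCycle_comm]
    constructor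
    · rintro ⟨⟨g, k, rfl⟩, rfl⟩
      exact ⟨k, rfl⟩
    · rintro ⟨k, rfl⟩
      exact ⟨⟨M.next ^ k, k, rfl⟩, rfl⟩
  have := Function.isPeriodicPt_minimalPeriod (M.next • ·) d
  rw [hp] at this
  exact this

end CombMap

section FirstReturn

variable {X : Type} [Finite X] (s : Equiv.Perm X) (p : X → Prop)

theorem exists_return (x : {x // p x}) : ∃ n : ℕ, 0 < n ∧ p ((s ^ n) x.1) :=
  ⟨orderOf s, orderOf_pos s, by rw [pow_orderOf_eq_one]; exact x.2⟩

/-- The number of iterations of `s` after which `x` comes back to `p` for the first time. -/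
noncomputable def returnTime (x : {x // p x}) : ℕ :=
  sInf {n : ℕ | 0 < n ∧ p ((s ^ n) x.1)}

theorem returnTime_spec (x : {x // p x}) :
    0 < returnTime s p x ∧ p ((s ^ returnTime s p x) x.1) :=
  Nat.sInf_mem (s := {n : ℕ | 0 < n ∧ p ((s ^ n) x.1)}) (exists_return s p x)

theorem returnTime_aux (x y : {x // p x})
    (h : (s ^ returnTime s p x) x.1 = (s ^ returnTime s p y) y.1)
    (hle : returnTime s p x ≤ returnTime s p y) : x = y := by
  obtain ⟨k, hk⟩ := Nat.exists_eq_add_of_le hle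
  rw [hk, pow_add, Equiv.Perm.mul_apply] at h
  have hx : x.1 = (s ^ k) y.1 := (s ^ returnTime s p x).injective h
  rcases Nat.eq_zero_or_pos k with h0 | h0
  · subst h0
    exact Subtype.ext hx
  · have h1 : returnTime s p y ≤ k :=
      Nat.sInf_le (show 0 < k ∧ p ((s ^ k) y.1) from ⟨h0, hx ▸ x.2⟩)
    have h2 := (returnTime_spec s p x).1
    omega

/-- The permutation of the elements that satisfy `p` induced by `s`: each of them is sent to the
first element satisfying `p` that is met when iterating `s`. -/
noncomputable def firstReturn : Equiv.Perm {x // p x} :=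
  Equiv.ofBijective (fun x => ⟨(s ^ returnTime s p x) x.1, (returnTime_spec s p x).2⟩)
    (Finite.injective_iff_bijective.1 fun x y h => by
      have h' := Subtype.ext_iff.1 h
      rcases le_total (returnTime s p x) (returnTime s p y) with hle | hle
      · exact returnTime_aux s p x y h' hle
      · exact (returnTime_aux s p y x h'.symm hle).symm)

end FirstReturn

/-- A combinatorial map with integer labels on the vertices (`label d` is the label of the starting
vertex of `d`) and a marked dart. -/
structure LabeledMap extends CombMap where
  label : Dart → ℤ
  label_rot : ∀ d, label (rot d) = label d
  root : Dart

namespace LabeledMap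

/-- Labels as a function on the vertices. -/
def vertexLabel (M : LabeledMap) : M.Vertex → ℤ :=
  Quotient.lift M.label (by
    intro a b h
    obtain ⟨n, -, -, rfl⟩ := Equiv.Perm.SameCycle.exists_pow_eq' (f := M.rot) h
    clear h
    induction n with
    | zero => rfl
    | succ k ih => rw [pow_succ', Equiv.Perm.mul_apply, M.label_rot]; exact ih)

theorem label_pow_rot (M : LabeledMap) (n : ℕ) (d : M.Dart) :
    M.label ((M.rot ^ n) d) = M.label d := by
  induction n with
  | zero => rfl
  | succ k ih => rw [pow_succ', Equiv.Perm.mul_apply, M.label_rot, ih]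

/-- The label of a vertex is smaller than or equal to the labels of all its neighbours. -/
def IsLocalMin (M : LabeledMap) (v : M.Vertex) : Prop :=
  ∀ d : M.Dart, M.start d = v → M.vertexLabel v ≤ M.vertexLabel (M.start (M.rev d))

/-- The label of a vertex is larger than or equal to the labels of all its neighbours. -/
def IsLocalMax (M : LabeledMap) (v : M.Vertex) : Prop :=
  ∀ d : M.Dart, M.start d = v → M.vertexLabel (M.start (M.rev d)) ≤ M.vertexLabel v

/-- `f` is an isomorphism of labeled maps (preserving the orientation of the surface), with no
condition on the marked darts. -/
structure IsIso (M N : LabeledMap) (f : M.Dart ≃ N.Dart) : Prop where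
  map_rot : ∀ d, f (M.rot d) = N.rot (f d)
  map_rev : ∀ d, f (M.rev d) = N.rev (f d)
  map_label : ∀ d, N.label (f d) = M.label d

theorem IsIso.refl (M : LabeledMap) : IsIso M M (Equiv.refl _) :=
  ⟨fun _ => rfl, fun _ => rfl, fun _ => rfl⟩

theorem IsIso.symm {M N : LabeledMap} {f : M.Dart ≃ N.Dart} (h : IsIso M N f) :
    IsIso N M f.symm where
  map_rot d := by rw [Equiv.symm_apply_eq, h.map_rot, Equiv.apply_symm_apply]
  map_rev d := by rw [Equiv.symm_apply_eq, h.map_rev, Equiv.apply_symm_apply]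
  map_label d := by rw [← h.map_label, Equiv.apply_symm_apply]

theorem IsIso.trans {M N P : LabeledMap} {f : M.Dart ≃ N.Dart} {g : N.Dart ≃ P.Dart}
    (h : IsIso M N f) (k : IsIso N P g) : IsIso M P (f.trans g) where
  map_rot d := by simp [h.map_rot, k.map_rot]
  map_rev d := by simp [h.map_rev, k.map_rev]
  map_label d := by simp [h.map_label, k.map_label]

end LabeledMap

/-- A representative of a labeled rooted quadrangulation of the sphere: the labels differ by exactly
one along every edge.  The root is the unoriented edge carrying the marked dart (the equivalence
below forgets which of its two darts is marked). -/
structure LabeledQuad extends LabeledMap where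
  planar : toCombMap.IsPlanarMap
  quad : toCombMap.IsQuadrangular
  label_rev : ∀ d, |label (rev d) - label d| = 1

/-- A representative of a labeled rooted planar map: the labels differ by at most one along every
edge.  The root edge is the marked dart, an oriented edge. -/
structure LabeledPlanarMap extends LabeledMap where
  planar : toCombMap.IsPlanarMap
  label_rev : ∀ d, |label (rev d) - label d| ≤ 1

/-- Equivalence of labeled quadrangulations with a marked unoriented edge. -/
instance LabeledQuad.setoid : Setoid LabeledQuad where
  r P Q := ∃ f : P.Dart ≃ Q.Dart, LabeledMap.IsIso P.toLabeledMap Q.toLabeledMap f ∧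
    (f P.root = Q.root ∨ f P.root = Q.rev Q.root)
  iseqv :=
    { refl := fun P => ⟨_, LabeledMap.IsIso.refl _, Or.inl rfl⟩
      symm := by
        rintro P Q ⟨f, h, hr⟩
        refine ⟨f.symm, h.symm, ?_⟩
        rw [Equiv.symm_apply_eq, Equiv.symm_apply_eq, h.map_rev]
        rcases hr with hr | hr
        · exact Or.inl hr.symm
        · right
          rw [hr, Q.rev_rev]
      trans := by
        rintro P Q R ⟨f, h, hr⟩ ⟨g, k, kr⟩
        refine ⟨f.trans g, h.trans k, ?_⟩
        rw [Equiv.trans_apply]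
        rcases hr with hr | hr <;> rcases kr with kr | kr
        · left; rw [hr, kr]
        · right; rw [hr, kr]
        · right; rw [hr, k.map_rev, kr]
        · left; rw [hr, k.map_rev, kr, R.rev_rev] }

/-- Equivalence of labeled planar maps with a marked oriented edge. -/
instance LabeledPlanarMap.setoid : Setoid LabeledPlanarMap where
  r M N := ∃ f : M.Dart ≃ N.Dart, LabeledMap.IsIso M.toLabeledMap N.toLabeledMap f ∧
    f M.root = N.root
  iseqv :=
    { refl := fun M => ⟨_, LabeledMap.IsIso.refl _, rfl⟩
      symm := by
        rintro M N ⟨f, h, hr⟩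
        exact ⟨f.symm, h.symm, by rw [Equiv.symm_apply_eq, hr]⟩
      trans := by
        rintro M N P ⟨f, h, hr⟩ ⟨g, k, kr⟩
        exact ⟨f.trans g, h.trans k, by rw [Equiv.trans_apply, hr, kr]⟩ }

/-- The set of labeled rooted quadrangulations of the sphere, up to equivalence. -/
abbrev LabeledQuadClass : Type 1 := Quotient LabeledQuad.setoid

/-- The set of labeled rooted planar maps, up to equivalence. -/
abbrev LabeledPlanarMapClass : Type 1 := Quotient LabeledPlanarMap.setoid

namespace LabeledQuad

/-- The face of the corner `c` is simple, with labels `t + 1, t, t - 1, t` in clockwise order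
starting from `c`; so `c` is its corner with largest label. -/
def SimpleTop (Q : LabeledQuad) (c : Q.Dart) : Prop :=
  Q.label (Q.next c) = Q.label c - 1 ∧ Q.label (Q.next (Q.next c)) = Q.label c - 2 ∧
    Q.label (Q.next (Q.next (Q.next c))) = Q.label c - 1

/-- The face of the corner `c` is confluent, with labels `t + 1, t, t + 1, t` in clockwise order
starting from `c`; so `c` is one of its two corners with largest label. -/
def ConfluentTop (Q : LabeledQuad) (c : Q.Dart) : Prop :=
  Q.label (Q.next c) = Q.label c - 1 ∧ Q.label (Q.next (Q.next c)) = Q.label c ∧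
    Q.label (Q.next (Q.next (Q.next c))) = Q.label c - 1

/-- Schaeffer's prescription: in a simple face the coloured edge is drawn along the side that joins
the corner with largest label to the next corner in clockwise order; in a confluent face it is the
diagonal joining the two corners with largest label.  `Q.Coloured c c'` says that the coloured edge
of some face joins the corners `c` and `c'` of that face. -/
def Coloured (Q : LabeledQuad) (c c' : Q.Dart) : Prop :=
  (Q.SimpleTop c ∧ c' = Q.next c) ∨ (Q.SimpleTop c' ∧ c = Q.next c') ∨
    (Q.ConfluentTop c ∧ c' = Q.next (Q.next c))

theorem label_next (Q : LabeledQuad) (d : Q.Dart) : |Q.label (Q.next d) - Q.label d| = 1 := by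
  have h : Q.label (Q.next d) = Q.label (Q.rev d) := Q.label_rot (Q.rev d)
  rw [h]
  exact Q.label_rev d

theorem Coloured.symm {Q : LabeledQuad} {c c' : Q.Dart} (h : Q.Coloured c c') :
    Q.Coloured c' c := by
  rcases h with h | h | ⟨⟨h1, h2, h3⟩, rfl⟩
  · exact Or.inr (Or.inl h)
  · exact Or.inl h
  · have h4 := Q.next_four Q.quad c
    refine Or.inr (Or.inr ⟨⟨?_, ?_, ?_⟩, h4.symm⟩)
    · omega
    · rw [h4]; omega
    · rw [h4]; omega

theorem Coloured.unique {Q : LabeledQuad} {c a b : Q.Dart} (ha : Q.Coloured c a)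
    (hb : Q.Coloured c b) : a = b := by
  have h4 := fun d => Q.next_four Q.quad d
  rcases ha with ⟨⟨a1, a2, a3⟩, rfl⟩ | ⟨⟨a1, a2, a3⟩, ha⟩ | ⟨⟨a1, a2, a3⟩, rfl⟩ <;>
  rcases hb with ⟨⟨b1, b2, b3⟩, rfl⟩ | ⟨⟨b1, b2, b3⟩, hb⟩ | ⟨⟨b1, b2, b3⟩, rfl⟩
  · rfl
  · subst hb; rw [h4] at a3; omega
  · omega
  · subst ha; rw [h4] at b3; omega
  · exact Q.next.injective (ha.symm.trans hb)
  · subst ha; rw [h4] at b3; omega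
  · omega
  · subst hb; rw [h4] at a3; omega
  · rfl

theorem Coloured.ne {Q : LabeledQuad} {c a : Q.Dart} (ha : Q.Coloured c a) : a ≠ c := by
  rintro rfl
  rcases ha with ⟨⟨a1, a2, a3⟩, h⟩ | ⟨⟨a1, a2, a3⟩, h⟩ | ⟨⟨a1, a2, a3⟩, h⟩
  · rw [← h] at a1; omega
  · rw [← h] at a1; omega
  · have h' := congrArg Q.next h
    rw [← h'] at a3
    -- the four corners of a face are distinct
    have hq := Q.quad (Q.rightFace a)
    have hs : {d : Q.Dart | Q.rightFace d = Q.rightFace a} ⊆ {a, Q.next a} := by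
      intro d hd
      have hd' : Q.next.SameCycle a d := by
        have := Quotient.exact (s := Equiv.Perm.SameCycle.setoid Q.next) hd
        exact Equiv.Perm.SameCycle.symm this
      obtain ⟨n, -, -, rfl⟩ := hd'.exists_pow_eq'
      clear hd hd'
      induction n with
      | zero => exact Or.inl rfl
      | succ k ih =>
        rw [pow_succ', Equiv.Perm.mul_apply]
        rcases ih with ih | ih
        · rw [ih]; exact Or.inr rfl
        · rw [Set.mem_singleton_iff.1 ih, ← h]; exact Or.inl rfl
    have h1 := Set.ncard_le_ncard hs (Set.toFinite _)
    have h2 : ({a, Q.next a} : Set Q.Dart).ncard ≤ 2 :=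
      (Set.ncard_insert_le _ _).trans (by rw [Set.ncard_singleton])
    have h3 : {d : Q.Dart | Q.rightFace d = Q.rightFace a}.ncard = 4 := hq
    omega

/-- On the right of every descending dart there is an end of a coloured edge. -/
theorem exists_coloured (Q : LabeledQuad) (d : Q.Dart) (h : Q.label (Q.rev d) < Q.label d) :
    ∃ c, Q.Coloured d c := by
  have h0 : Q.label (Q.next d) = Q.label (Q.rev d) := Q.label_rot (Q.rev d)
  have h4 := Q.next_four Q.quad d
  have k1 := Q.label_next d
  have k2 := Q.label_next (Q.next d)
  have k3 := Q.label_next (Q.next (Q.next d))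
  have k4 := Q.label_next (Q.next (Q.next (Q.next d)))
  rw [h4] at k4
  rw [abs_eq one_pos.le] at k1 k2 k3 k4
  by_cases e2 : Q.label (Q.next (Q.next d)) = Q.label d
  · by_cases e3 : Q.label (Q.next (Q.next (Q.next d))) = Q.label d - 1
    · exact ⟨_, Or.inr (Or.inr ⟨⟨by omega, e2, e3⟩, rfl⟩)⟩
    · refine ⟨Q.next (Q.next (Q.next d)), Or.inr (Or.inl ⟨⟨?_, ?_, ?_⟩, h4.symm⟩)⟩ <;>
        rw [h4] <;> omega
  · exact ⟨_, Or.inl ⟨⟨by omega, by omega, by omega⟩, rfl⟩⟩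

/-- The corners of `Q` containing an end of a coloured edge; equivalently, the darts (oriented
edges) of the coloured graph, each placed in the corner of `Q` in which it starts. -/
abbrev ColouredDart (Q : LabeledQuad) : Type := {c : Q.Dart // ∃ c', Q.Coloured c c'}

/-- The other end of a coloured edge. -/
noncomputable def otherEnd (Q : LabeledQuad) (c : Q.ColouredDart) : Q.ColouredDart :=
  ⟨Classical.choose c.2, c.1, (Classical.choose_spec c.2).symm⟩

theorem otherEnd_otherEnd (Q : LabeledQuad) (c : Q.ColouredDart) :
    Q.otherEnd (Q.otherEnd c) = c :=
  Subtype.ext (Coloured.unique (Classical.choose_spec (Q.otherEnd c).2)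
    (Classical.choose_spec c.2).symm)

/-- The dart of the root edge that starts at its end point with largest label. -/
def topRoot (Q : LabeledQuad) : Q.Dart :=
  if Q.label (Q.rev Q.root) < Q.label Q.root then Q.root else Q.rev Q.root

theorem topRoot_desc (Q : LabeledQuad) : Q.label (Q.rev Q.topRoot) < Q.label Q.topRoot := by
  unfold topRoot
  split_ifs with h
  · exact h
  · have := Q.label_rev Q.root
    rw [Q.rev_rev]
    rw [abs_eq one_pos.le] at this
    omega

/-- The coloured edge that ends in the corner of `Q` directly on the right of `Q.topRoot`. -/
def topColoured (Q : LabeledQuad) : Q.ColouredDart :=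
  ⟨Q.topRoot, Q.exists_coloured _ Q.topRoot_desc⟩

/-- The coloured graph of `Q`.  Its vertices are the vertices of `Q` that lie on a coloured edge,
with their labels, and around each of them the coloured edges are in the order inherited from `Q`.

Root: the larger end of the root edge of `Q` starts with the dart `Q.topRoot`, which lies in the
sector of the coloured graph that goes anticlockwise from the coloured dart `Q.topColoured`
(situated directly on the right of `Q.topRoot`) to the following coloured dart `e`.  This sector is
the root corner.  The root edge is the oriented edge whose root corner, i.e. the corner on its left
at its end point, is this sector: it is the reversal of `e`. -/
noncomputable def colouredMap (Q : LabeledQuad) : LabeledMap where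
  Dart := Q.ColouredDart
  rot := firstReturn Q.rot _
  rev := Function.Involutive.toPerm Q.otherEnd Q.otherEnd_otherEnd
  rev_rev := Q.otherEnd_otherEnd
  rev_ne c h := (Classical.choose_spec c.2).ne (congrArg Subtype.val h)
  label c := Q.label c.1
  label_rot c := Q.label_pow_rot _ c.1
  root := Q.otherEnd (firstReturn Q.rot _ Q.topColoured)

end LabeledQuad

/-! Schaeffer's rule has an explicit inverse, `quadrangulate`. Every corner of `M`, of label `ℓ`
say, sends an edge to the first corner of smaller label met backwards along the contour of its face;
labels change by at most one per step, so that label is `ℓ - 1`. If the contour has no smaller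
label, the edge goes to a new vertex of label `ℓ - 1` inside the face. The darts of the result are
`M.Dart × Bool`: `(d, false)` descends from the corner between `d` and `M.rot d`, and `(d, true)` is
its reversal.

Each edge of `M` is enclosed in one face of degree four (`IsGentle.stepFun_four`), and the vertices
of the result are the vertices and the faces of `M` (`IsGentle.vertexEquiv`). With `V`, `E`, `F`
counted in `M`, the result has `V + F` vertices, `2E` edges and `E` faces, hence the same Euler
characteristic; connectedness also passes both ways (`IsGentle.isPlanarMap_quadrangulate`). The
construction itself needs neither connectedness nor planarity, so both can be deduced for the
coloured map of `Q` once `Q` is recovered from it.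

One composition is local: in `M.toQuad` the coloured darts are the `(d, false)`, joined and rotated
as in `M` (`isIso_colouredEquiv`). The other (`exists_isIso_quadrangulate`) must show that the edges
of `Q` are the ones prescribed by the contours of the coloured map. The key is `chain_of_firstHit`:
a walk along a contour down to a level is shadowed by a descent along edges of `Q`, each lowering
the label by one. Hence `next_of_level`, and the face permutations agree. The six statistics are
then read off on `quadrangulate` and carried along isomorphisms. -/

/-! ### First hits of a permutation. -/

/-- `y` is the first of `s x, s (s x), …` that satisfies `p`. -/
inductive FirstHit {X : Type} (s : Equiv.Perm X) (p : X → Prop) : X → X → Prop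
  | hit {x : X} : p (s x) → FirstHit s p x (s x)
  | step {x y : X} : ¬ p (s x) → FirstHit s p (s x) y → FirstHit s p x y

namespace FirstHit

variable {X Y : Type} {s : Equiv.Perm X} {p q : X → Prop} {x y z : X}

theorem holds (h : FirstHit s p x y) : p y := by
  induction h with
  | hit h => exact h
  | step _ _ ih => exact ih

theorem eq_of_hit (h : FirstHit s p x y) (hp : p (s x)) : y = s x := by
  cases h with
  | hit _ => rfl
  | step h _ => exact absurd hp h

theorem of_step (h : FirstHit s p x y) (hp : ¬ p (s x)) : FirstHit s p (s x) y := by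
  cases h with
  | hit h => exact absurd h hp
  | step _ h => exact h

theorem unique (h : FirstHit s p x y) (k : FirstHit s p x z) : y = z := by
  induction h with
  | hit h => exact (k.eq_of_hit h).symm
  | step h _ ih => exact ih (k.of_step h)

theorem congr (h : FirstHit s p x y) (e : ∀ a, p a ↔ q a) : FirstHit s q x y := by
  induction h with
  | hit h => exact .hit ((e _).1 h)
  | step h _ ih => exact .step (fun k => h ((e _).2 k)) ih

theorem map {s' : Equiv.Perm Y} {p' : Y → Prop} (f : X ≃ Y) (hs : ∀ a, f (s a) = s' (f a))
    (hp : ∀ a, p a ↔ p' (f a)) (h : FirstHit s p x y) : FirstHit s' p' (f x) (f y) := by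
  induction h with
  | hit h => rw [hs]; exact .hit (by rw [← hs]; exact (hp _).1 h)
  | step h _ ih =>
    rw [hs] at ih
    exact .step (by rw [← hs]; exact fun k => h ((hp _).2 k)) ih

theorem exists_pow (h : FirstHit s p x y) : ∃ n : ℕ, (s ^ n) x = y := by
  induction h with
  | hit h => exact ⟨1, rfl⟩
  | step _ _ ih =>
    obtain ⟨n, hn⟩ := ih
    exact ⟨n + 1, by rw [pow_succ, Equiv.Perm.mul_apply, hn]⟩

/-- The element before the first hit is the starting point or not a hit. -/
theorem before (h : FirstHit s p x y) : (p (s x) ∧ y = s x) ∨ (¬ p (s x) ∧ ¬ p (s.symm y)) := by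
  induction h with
  | hit h => exact Or.inl ⟨h, rfl⟩
  | @step x y h k ih =>
    refine Or.inr ⟨h, ?_⟩
    rcases ih with ⟨_, rfl⟩ | ⟨_, ih⟩
    · rwa [Equiv.symm_apply_apply]
    · exact ih

/-- Passes from the least exponent defining `firstReturn` to the inductive form, which supports
induction along walks. -/
theorem of_pow {n : ℕ} (hn : 0 < n) (hp : p ((s ^ n) x))
    (hm : ∀ m, 0 < m → m < n → ¬ p ((s ^ m) x)) : FirstHit s p x ((s ^ n) x) := by
  induction n generalizing x with
  | zero => omega
  | succ k ih =>
    rcases Nat.eq_zero_or_pos k with rfl | hk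
    · exact .hit hp
    · rw [pow_succ, Equiv.Perm.mul_apply] at hp ⊢
      refine .step (hm 1 one_pos (by omega)) (ih hk hp fun m h0 h1 => ?_)
      have := hm (m + 1) (by omega) (by omega)
      rwa [pow_succ, Equiv.Perm.mul_apply] at this

theorem firstReturn [Finite X] (s : Equiv.Perm X) (p : X → Prop) (x : {x // p x}) :
    FirstHit s p x.1 (firstReturn s p x).1 := by
  obtain ⟨h0, h1⟩ := returnTime_spec s p x
  refine of_pow h0 h1 fun m hm hlt hp => ?_
  have : returnTime s p x ≤ m := Nat.sInf_le ⟨hm, hp⟩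
  omega

/-- First hits run backwards. -/
theorem symm (h : FirstHit s p x y) (hx : p x) : FirstHit s.symm p y x := by
  have back : ∀ a, (a = x ∨ ¬ p a ∧ FirstHit s.symm p a x) → FirstHit s.symm p (s a) x := by
    rintro a (rfl | ⟨ha, k⟩)
    · have := FirstHit.hit (s := s.symm) (p := p) (x := s a) (by simpa using hx)
      simpa using this
    · exact .step (by simpa using ha) (by simpa using k)
  -- The current point `a` of the walk carries with it the reversed walk from `a` to `x`.
  have gen : ∀ {a}, FirstHit s p a y → (a = x ∨ ¬ p a ∧ FirstHit s.symm p a x) →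
      FirstHit s.symm p y x := by
    clear h
    intro a h
    induction h with
    | hit _ => exact fun k => back _ k
    | step h _ ih => exact fun k => ih (Or.inr ⟨h, back _ k⟩)
  exact gen h (Or.inl rfl)

end FirstHit

/-! ### Contours of faces and the inverse construction. -/

namespace LabeledMap

variable (M : LabeledMap)

/-- The labels differ by at most one along every edge. -/
def IsGentle : Prop := ∀ d, |M.label (M.rev d) - M.label d| ≤ 1

/-- The step backwards along the contour of a face. -/
def back : Equiv.Perm M.Dart := M.rev.trans M.rot.symm

theorem rot_back (d : M.Dart) : M.rot (M.back d) = M.rev d := by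
  simp [back]

theorem back_symm_apply (d : M.Dart) : M.back.symm d = M.rev (M.rot d) := by
  rw [Equiv.symm_apply_eq]
  simp [back, M.rev_rev]

theorem label_back (d : M.Dart) : M.label (M.back d) = M.label (M.rev d) := by
  rw [← M.label_rot, rot_back]

/-- The first corner met backwards along the contour of the face whose label is not larger. -/
noncomputable def pred (d : M.Dart) : M.Dart :=
  (firstReturn M.back (fun e => M.label e ≤ M.label d) ⟨d, le_rfl⟩).1

/-- The first corner met forwards along the contour of the face whose label is not larger. -/
noncomputable def succ (d : M.Dart) : M.Dart :=
  (firstReturn M.back.symm (fun e => M.label e ≤ M.label d) ⟨d, le_rfl⟩).1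

theorem firstHit_pred (d : M.Dart) :
    FirstHit M.back (fun e => M.label e ≤ M.label d) d (M.pred d) :=
  FirstHit.firstReturn M.back (fun e => M.label e ≤ M.label d) ⟨d, le_rfl⟩

theorem firstHit_succ (d : M.Dart) :
    FirstHit M.back.symm (fun e => M.label e ≤ M.label d) d (M.succ d) :=
  FirstHit.firstReturn M.back.symm (fun e => M.label e ≤ M.label d) ⟨d, le_rfl⟩

theorem pred_of_le {d : M.Dart} (h : M.label (M.rev d) ≤ M.label d) : M.pred d = M.back d :=
  (M.firstHit_pred d).eq_of_hit (by rwa [label_back])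

/-- With equal labels the two stopping conditions coincide, so the walk can be reversed. -/
theorem succ_pred {d : M.Dart} (h : M.label (M.pred d) = M.label d) : M.succ (M.pred d) = d :=
  (M.firstHit_succ _).unique
    (((M.firstHit_pred d).symm le_rfl).congr fun a => by rw [h])

theorem pred_succ {d : M.Dart} (h : M.label (M.succ d) = M.label d) : M.pred (M.succ d) = d := by
  have := ((M.firstHit_succ d).symm le_rfl).congr
    (q := fun e => M.label e ≤ M.label (M.succ d)) fun a => by rw [h]
  rw [Equiv.symm_symm] at this
  exact (M.firstHit_pred _).unique this

/-- The edge of the corner after `pred d` goes up, unless it leads directly to `d`. -/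
theorem label_lt_of_pred {d : M.Dart} (h : M.label d < M.label (M.rev d)) :
    M.label d < M.label (M.rev (M.rot (M.pred d))) := by
  rcases (M.firstHit_pred d).before with ⟨k, -⟩ | ⟨-, k⟩
  · rw [label_back] at k; omega
  · rwa [back_symm_apply, not_le] at k

variable {M}

theorem IsGentle.le (hM : M.IsGentle) (d : M.Dart) :
    M.label d - 1 ≤ M.label (M.rev d) ∧ M.label (M.rev d) ≤ M.label d + 1 := by
  have := abs_le.1 (hM d)
  omega

/-- The corner just before a later hit is strictly above the level of `d`, and one step drops by at
most one, so the hit cannot land below that level. -/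
theorem IsGentle.label_pred (hM : M.IsGentle) {d : M.Dart} (h : M.label d ≤ M.label (M.rev d)) :
    M.label (M.pred d) = M.label d := by
  rcases (M.firstHit_pred d).before with ⟨k, e⟩ | ⟨-, k⟩
  · rw [e]; rw [label_back] at k ⊢; omega
  · have h1 := (M.firstHit_pred d).holds
    have h2 := (hM.le (M.back.symm (M.pred d))).1
    rw [← label_back, Equiv.apply_symm_apply] at h2
    omega

theorem IsGentle.label_succ (hM : M.IsGentle) {d : M.Dart}
    (h : M.label d < M.label (M.rev (M.rot d))) :
    M.label (M.succ d) = M.label d ∧ M.label (M.rev (M.succ d)) = M.label d + 1 := by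
  rcases (M.firstHit_succ d).before with ⟨k, e⟩ | ⟨-, k⟩
  · rw [back_symm_apply] at k; omega
  · have h1 := (M.firstHit_succ d).holds
    rw [Equiv.symm_symm, label_back] at k
    have h2 := (hM.le (M.succ d)).2
    omega

/-- The clockwise step around the faces of the quadrangulation associated with `M`.  The darts of
this quadrangulation are the descending darts `(d, false)`, which start at the corners of `M`, and
their reversals `(d, true)`. -/
noncomputable def stepFun (M : LabeledMap) : M.Dart × Bool → M.Dart × Bool
  | (d, false) => if M.label (M.rev d) < M.label d then (M.rev d, false) else (M.pred d, true)
  | (d, true) => if M.label (M.rev (M.rot d)) ≤ M.label d then (M.rot d, false)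
      else (M.back (M.succ d), true)

theorem stepFun_desc {d : M.Dart} (h : M.label (M.rev d) < M.label d) :
    M.stepFun (d, false) = (M.rev d, false) := if_pos h

theorem stepFun_level {d : M.Dart} (h : M.label d ≤ M.label (M.rev d)) :
    M.stepFun (d, false) = (M.pred d, true) := if_neg (not_lt.2 h)

theorem stepFun_top {d : M.Dart} (h : M.label (M.rev (M.rot d)) ≤ M.label d) :
    M.stepFun (d, true) = (M.rot d, false) := if_pos h

theorem stepFun_up {d : M.Dart} (h : M.label d < M.label (M.rev (M.rot d))) :
    M.stepFun (d, true) = (M.back (M.succ d), true) := if_neg (not_le.2 h)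

theorem stepFun_back {d : M.Dart} (h : M.label d ≤ M.label (M.rev d)) :
    M.stepFun (M.back d, true) = (M.rev d, false) := by
  rw [stepFun_top, rot_back]
  rw [rot_back, M.rev_rev, label_back]
  exact h

theorem IsGentle.stepFun_pred (hM : M.IsGentle) {d : M.Dart}
    (h : M.label d < M.label (M.rev d)) :
    M.stepFun (M.pred d, true) = (M.back d, true) := by
  have e := hM.label_pred h.le
  rw [stepFun_up, M.succ_pred e]
  rw [e]
  exact M.label_lt_of_pred h

/-- An edge with strictly smaller end `d` has the face `(d, false)`, `(pred d, true)`, `(back d,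
true)`, `(rev d, false)`. For an edge with equal labels the face is `(d, false)`, `(back d, true)`,
`(rev d, false)`, `(back (rev d), true)`. -/
theorem IsGentle.stepFun_four (hM : M.IsGentle) (z : M.Dart × Bool) :
    M.stepFun (M.stepFun (M.stepFun (M.stepFun z))) = z ∧ M.stepFun (M.stepFun z) ≠ z := by
  -- the face of a simple edge, from its smaller end
  have mid : ∀ d, M.label d < M.label (M.rev d) →
      M.stepFun (d, false) = (M.pred d, true) ∧ M.stepFun (M.pred d, true) = (M.back d, true) ∧
      M.stepFun (M.back d, true) = (M.rev d, false) ∧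
      M.stepFun (M.rev d, false) = (d, false) := fun d h =>
    ⟨stepFun_level h.le, hM.stepFun_pred h, stepFun_back h.le, by
      rw [stepFun_desc, M.rev_rev]; rwa [M.rev_rev]⟩
  -- the face of a confluent edge
  have conf : ∀ d, M.label (M.rev d) = M.label d →
      M.stepFun (d, false) = (M.back d, true) ∧ M.stepFun (M.back d, true) = (M.rev d, false) :=
    fun d h => ⟨by rw [stepFun_level h.ge, M.pred_of_le h.le], stepFun_back h.ge⟩
  have sq : ∀ d, M.label (M.rev (M.rev d)) = M.label d := fun d => by rw [M.rev_rev]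
  rcases z with ⟨d, _ | _⟩
  · rcases lt_trichotomy (M.label d) (M.label (M.rev d)) with h | h | h
    · obtain ⟨h1, h2, h3, h4⟩ := mid d h
      simp [h1, h2, h3, h4]
    · obtain ⟨h1, h2⟩ := conf d h.symm
      obtain ⟨h3, h4⟩ := conf (M.rev d) (by rw [sq, h])
      simp [h1, h2, h3, h4, M.rev_rev, M.rev_ne]
    · obtain ⟨h1, h2, h3, h4⟩ := mid (M.rev d) (by rwa [sq])
      rw [M.rev_rev] at h3 h4
      simp [h1, h2, h3, h4]
  -- The dart `(d, true)` lies in the face of the edge `rot d`, or of the edge `succ d` when `rot d`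
  -- rises.
  · by_cases h : M.label (M.rev (M.rot d)) ≤ M.label d
    · have h0 := stepFun_top h
      have hd : M.back (M.rev (M.rot d)) = d := by simp [back, M.rev_rev]
      rw [← M.label_rot d] at h
      rcases h.lt_or_eq with h | h
      · obtain ⟨h1, h2, h3, h4⟩ := mid (M.rev (M.rot d)) (by rwa [sq])
        rw [M.rev_rev] at h3 h4
        rw [hd] at h2 h3
        simp [h0, h1, h2, h4]
      · obtain ⟨h1, h2⟩ := conf _ h
        obtain ⟨h3, h4⟩ := conf _ ((sq _).trans h.symm)
        rw [hd] at h3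
        rw [h0, h1, h2]
        refine ⟨h3, fun e => ?_⟩
        have e1 := congrArg Prod.fst e
        have e2 : M.rot (M.back (M.rot d)) = M.rot d := congrArg M.rot e1
        rw [rot_back] at e2
        exact M.rev_ne _ e2
    · rw [not_le] at h
      obtain ⟨l1, l2⟩ := hM.label_succ h
      obtain ⟨h1, h2, h3, h4⟩ := mid (M.succ d) (by omega)
      rw [M.pred_succ l1] at h1 h2
      simp [h1, h2, h3, h4]

/-- Clockwise rotation around the faces of the quadrangulation associated with `M`. -/
noncomputable def IsGentle.stepPerm (hM : M.IsGentle) : Equiv.Perm (M.Dart × Bool) where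
  toFun := M.stepFun
  invFun z := M.stepFun (M.stepFun (M.stepFun z))
  left_inv z := (hM.stepFun_four z).1
  right_inv z := (hM.stepFun_four z).1

/-- The reversal of the darts of the quadrangulation associated with `M`. -/
def flip (M : LabeledMap) : Equiv.Perm (M.Dart × Bool) :=
  (Equiv.refl M.Dart).prodCongr Equiv.boolNot

theorem flip_apply (d : M.Dart) (b : Bool) : M.flip (d, b) = (d, !b) := rfl

/-- The label of the starting vertex of a dart of the quadrangulation associated with `M`. -/
def quadLabel (M : LabeledMap) : M.Dart × Bool → ℤ
  | (d, false) => M.label d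
  | (d, true) => M.label d - 1

/-- Rotation in the quadrangulation is `flip` followed by `stepFun`; this is why labels are constant
around its vertices. -/
theorem IsGentle.quadLabel_stepFun (hM : M.IsGentle) (z : M.Dart × Bool) :
    M.quadLabel (M.stepFun z) = M.quadLabel (M.flip z) := by
  rcases z with ⟨d, _ | _⟩
  · rcases lt_or_ge (M.label (M.rev d)) (M.label d) with h | h
    · rw [stepFun_desc h]
      have := (hM.le d).1
      simp only [quadLabel, flip_apply, Bool.not_false]
      omega
    · rw [stepFun_level h]
      simp only [quadLabel, flip_apply, Bool.not_false, hM.label_pred h]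
  · rcases le_or_gt (M.label (M.rev (M.rot d))) (M.label d) with h | h
    · rw [stepFun_top h]
      exact M.label_rot d
    · rw [stepFun_up h]
      simp only [quadLabel, flip_apply, Bool.not_true, label_back, (hM.label_succ h).2]
      omega

/-- The quadrangulation associated with a labeled map: every corner of the map is joined to the
first corner with smaller label met backwards along the contour of its face, or to a new vertex in
the face if there is none. -/
noncomputable def quadrangulate (M : LabeledMap) (hM : M.IsGentle) : LabeledMap where
  Dart := M.Dart × Bool
  rot := M.flip.trans hM.stepPerm
  rev := M.flip
  rev_rev := fun ⟨d, b⟩ => by simp [flip_apply]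
  rev_ne := fun ⟨d, b⟩ => by simp [flip_apply]
  label := M.quadLabel
  label_rot z := by
    have := hM.quadLabel_stepFun (M.flip z)
    rwa [show M.flip (M.flip z) = z by rcases z with ⟨d, b⟩; simp [flip_apply]] at this
  -- The root corner lies between `back root` and `rev root`, so the descending dart issued from it
  -- is indexed by `back root`.
  root := (M.back M.root, false)

variable (hM : M.IsGentle)

theorem quadrangulate_rot (d : M.Dart) (b : Bool) :
    (M.quadrangulate hM).rot (d, b) = M.stepFun (d, !b) := rfl

theorem quadrangulate_next (z : M.Dart × Bool) :
    (M.quadrangulate hM).next z = M.stepFun z := by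
  rcases z with ⟨d, b⟩
  change M.stepFun (M.flip (M.flip (d, b))) = _
  simp [flip_apply]

theorem quadrangulate_label_rev (z : (M.quadrangulate hM).Dart) :
    |(M.quadrangulate hM).label ((M.quadrangulate hM).rev z) - (M.quadrangulate hM).label z| = 1 := by
  rcases z with ⟨d, _ | _⟩
  · change |M.label d - 1 - M.label d| = 1
    simp
  · change |M.label d - (M.label d - 1)| = 1
    simp

end LabeledMap

/-! ### Counting darts by edges and by faces. -/

namespace CombMap

variable (M : CombMap)

instance : Finite M.Vertex := inferInstanceAs (Finite (Quotient _))
instance : Finite M.Edge := inferInstanceAs (Finite (Quotient _))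
instance : Finite M.Face := inferInstanceAs (Finite (Quotient _))

theorem start_eq {d e : M.Dart} : M.start d = M.start e ↔ M.rot.SameCycle d e :=
  Quotient.eq (r := Equiv.Perm.SameCycle.setoid M.rot)

theorem rightFace_eq {d e : M.Dart} : M.rightFace d = M.rightFace e ↔ M.next.SameCycle d e :=
  Quotient.eq (r := Equiv.Perm.SameCycle.setoid M.next)

theorem start_rot (d : M.Dart) : M.start (M.rot d) = M.start d :=
  M.start_eq.2 (Equiv.Perm.SameCycle.refl _ _).apply_left

theorem rightFace_next (d : M.Dart) : M.rightFace (M.next d) = M.rightFace d :=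
  M.rightFace_eq.2 (Equiv.Perm.SameCycle.refl _ _).apply_left

/-- Counting the elements of a finite type along a map with fibres of constant size. -/
theorem card_eq_mul_of_fibers {X Y : Type} [Finite X] [Finite Y] (f : X → Y) {k : ℕ}
    (h : ∀ y, Nat.card {x // f x = y} = k) : Nat.card X = Nat.card Y * k := by
  have := Fintype.ofFinite Y
  rw [← Nat.card_congr (Equiv.sigmaFiberEquiv f), Nat.card_sigma]
  simp [h]

theorem card_dart_eq_edge : Nat.card M.Dart = Nat.card M.Edge * 2 := by
  refine card_eq_mul_of_fibers
    (Quotient.mk (Equiv.Perm.SameCycle.setoid M.rev) : M.Dart → M.Edge) fun y => ?_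
  obtain ⟨d, rfl⟩ := Quotient.exists_rep y
  have hs : {x : M.Dart | Quotient.mk (Equiv.Perm.SameCycle.setoid M.rev) x =
      Quotient.mk (Equiv.Perm.SameCycle.setoid M.rev) d} = {d, M.rev d} := by
    ext x
    rw [Set.mem_ofPred_eq, Quotient.eq (r := Equiv.Perm.SameCycle.setoid M.rev)]
    constructor
    · intro h
      obtain ⟨n, -, rfl⟩ := h.symm.exists_pow_eq'
      clear h
      induction n with
      | zero => exact Or.inl rfl
      | succ k ih =>
        rw [pow_succ', Equiv.Perm.mul_apply]
        rcases ih with ih | ih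
        · rw [ih]; exact Or.inr rfl
        · rw [Set.mem_singleton_iff.1 ih, M.rev_rev]; exact Or.inl rfl
    · rintro (rfl | h)
      · exact Equiv.Perm.SameCycle.refl _ _
      · rw [Set.mem_singleton_iff.1 h]
        exact (Equiv.Perm.SameCycle.refl _ _).apply_left
  change Set.ncard {x : M.Dart | _} = 2
  rw [hs]
  exact Set.ncard_pair (M.rev_ne d).symm

theorem card_dart_eq_face (h : M.IsQuadrangular) : Nat.card M.Dart = Nat.card M.Face * 4 :=
  card_eq_mul_of_fibers M.rightFace h

/-- Cycle lengths divide four, and the square having no fixed point excludes one and two. -/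
theorem isQuadrangular_of_next (h4 : ∀ d, M.next (M.next (M.next (M.next d))) = d)
    (h2 : ∀ d, M.next (M.next d) ≠ d) : M.IsQuadrangular := by
  intro f
  obtain ⟨d, rfl⟩ := Quotient.exists_rep f
  have h1 : ∀ d, M.next d ≠ d := fun d h => h2 d (by rw [h, h])
  have hs : {x : M.Dart | M.rightFace x = M.rightFace d} =
      {d, M.next d, M.next (M.next d), M.next (M.next (M.next d))} := by
    ext x
    rw [Set.mem_ofPred_eq, rightFace_eq]
    constructor
    · intro h
      obtain ⟨n, -, rfl⟩ := h.symm.exists_pow_eq'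
      clear h
      induction n with
      | zero => exact Or.inl rfl
      | succ k ih =>
        rw [pow_succ', Equiv.Perm.mul_apply]
        simp only [Set.mem_insert_iff, Set.mem_singleton_iff] at ih ⊢
        rcases ih with ih | ih | ih | ih <;> rw [ih] <;> simp [h4]
    · have h0 := Equiv.Perm.SameCycle.refl M.next d
      rintro (rfl | rfl | rfl | rfl)
      · exact h0
      · exact h0.apply_left
      · exact h0.apply_left.apply_left
      · exact h0.apply_left.apply_left.apply_left
  change Set.ncard {x : M.Dart | M.rightFace x = M.rightFace d} = 4
  have h3 : M.next (M.next (M.next d)) ≠ d :=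
    fun h => h1 d ((congrArg M.next h).symm.trans (h4 d))
  rw [hs, Set.ncard_insert_of_notMem, Set.ncard_insert_of_notMem, Set.ncard_pair (h1 _).symm]
  · rintro (h | h)
    · exact h1 _ h.symm
    · exact h2 _ h.symm
  · rintro (h | h | h)
    · exact h1 _ h.symm
    · exact h2 _ h.symm
    · exact h3 h.symm

end CombMap

/-! ### Faces and vertices of the quadrangulation. -/

namespace LabeledMap

theorem quadrangulate_isQuadrangular {M : LabeledMap} (hM : M.IsGentle) :
    (M.quadrangulate hM).IsQuadrangular := by
  have e : ⇑(M.quadrangulate hM).next = M.stepFun := funext (quadrangulate_next hM)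
  refine CombMap.isQuadrangular_of_next _ (fun d => ?_) fun d => ?_ <;> rw [e]
  · exact (hM.stepFun_four d).1
  · exact (hM.stepFun_four d).2

section Vertices

variable {M : LabeledMap}

/-- `M.Below y d`: the corner `d` is the first one with a label smaller than that of `y` that is met
backwards along the contour of the face. -/
def Below (M : LabeledMap) (y d : M.Dart) : Prop :=
  FirstHit M.back (fun e => M.label e < M.label y) y d

theorem below_back {y : M.Dart} (h : M.label (M.rev y) < M.label y) : M.Below y (M.back y) :=
  .hit (by rwa [label_back])

theorem below_of_firstHit {p : M.Dart → Prop} {t : ℤ} (hp : ∀ e, p e ↔ M.label e ≤ t)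
    {y z d : M.Dart} (h : FirstHit M.back p y z)
    (k : FirstHit M.back (fun e => M.label e < t) y d) (hz : M.label z = t) :
    FirstHit M.back (fun e => M.label e < t) z d := by
  induction h with
  | hit h => exact k.of_step (by omega)
  | step h _ ih => exact ih (k.of_step fun e => h ((hp _).2 (le_of_lt e))) hz

theorem firstHit_of_below {p : M.Dart → Prop} {t : ℤ} (hp : ∀ e, p e ↔ M.label e ≤ t)
    {y z d : M.Dart} (h : FirstHit M.back p y z)
    (k : FirstHit M.back (fun e => M.label e < t) z d) (hz : M.label z = t) :
    FirstHit M.back (fun e => M.label e < t) y d := by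
  induction h with
  | hit h => exact .step (by omega) k
  | step h _ ih => exact .step (fun e => h ((hp _).2 (le_of_lt e))) (ih k hz)

/-- The walk from `y` to `pred y` stays at or above the level of `y`, so it meets no smaller label.
-/
theorem IsGentle.below_pred (hM : M.IsGentle) {y d : M.Dart} (h : M.label y ≤ M.label (M.rev y)) :
    M.Below (M.pred y) d ↔ M.Below y d := by
  have e := hM.label_pred h
  unfold Below
  rw [e]
  exact ⟨fun k => firstHit_of_below (fun _ => Iff.rfl) (M.firstHit_pred y) k e,
    fun k => below_of_firstHit (fun _ => Iff.rfl) (M.firstHit_pred y) k e⟩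

/-- The label of `back (succ d)` is one more than that of `d`, so being smaller than it means being
at most the label of `d`; and `d` is `pred (succ d)`. -/
theorem IsGentle.below_back_succ (hM : M.IsGentle) {d : M.Dart} (h : M.label d < M.label (M.rev (M.rot d))) :
    M.Below (M.back (M.succ d)) d := by
  obtain ⟨h1, h2⟩ := hM.label_succ h
  have k := M.firstHit_pred (M.succ d)
  rw [M.pred_succ h1] at k
  refine (k.of_step (by rw [label_back]; omega)).congr fun e => ?_
  rw [label_back]
  omega

/-- Rotating in the quadrangulation from a descending dart to the next one is rotating in `M`. -/
theorem IsGentle.firstHit_rot (hM : M.IsGentle) (d : M.Dart) :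
    FirstHit (M.quadrangulate hM).rot (fun z => z.2 = false) (d, false) (M.rot d, false) := by
  -- The induction also needs the ascending darts crossed on the way: `Below z.1 x` is the invariant
  -- telling that such a dart sits in the corner `x`.
  have gen : ∀ z w, FirstHit (M.quadrangulate hM).rot (fun z => z.2 = false) z w →
      (z.2 = false → w = (M.rot z.1, false)) ∧
      ∀ x, z.2 = true → M.Below z.1 x → w = (M.rot x, false) := by
    intro z w h
    induction h with
    | @hit z h =>
      rcases z with ⟨y, _ | _⟩
      · refine ⟨fun _ => ?_, by simp⟩
        rw [quadrangulate_rot, Bool.not_false] at h ⊢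
        rcases le_or_gt (M.label (M.rev (M.rot y))) (M.label y) with k | k
        · exact stepFun_top k
        · rw [stepFun_up k] at h; cases h
      · refine ⟨by simp, fun x _ hx => ?_⟩
        rw [quadrangulate_rot, Bool.not_true] at h ⊢
        rcases lt_or_ge (M.label (M.rev y)) (M.label y) with k | k
        · rw [stepFun_desc k, hx.unique (below_back k), rot_back]
        · rw [stepFun_level k] at h; cases h
    | @step z w h _ ih =>
      rcases z with ⟨y, _ | _⟩
      · refine ⟨fun _ => ?_, by simp⟩
        rw [quadrangulate_rot, Bool.not_false] at h ih
        rcases le_or_gt (M.label (M.rev (M.rot y))) (M.label y) with k | k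
        · rw [stepFun_top k] at h; exact absurd rfl h
        · rw [stepFun_up k] at ih
          exact ih.2 y rfl (hM.below_back_succ k)
      · refine ⟨by simp, fun x _ hx => ?_⟩
        rw [quadrangulate_rot, Bool.not_true] at h ih
        rcases lt_or_ge (M.label (M.rev y)) (M.label y) with k | k
        · rw [stepFun_desc k] at h; exact absurd rfl h
        · rw [stepFun_level k] at ih
          exact ih.2 x rfl ((hM.below_pred k).2 hx)
  have h := FirstHit.firstReturn (M.quadrangulate hM).rot (fun z => z.2 = false) ⟨(d, false), rfl⟩
  have e := (gen _ _ h).1 rfl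
  rw [e] at h
  exact h

theorem sameCycle_of_firstHit {X : Type} {s : Equiv.Perm X} {p : X → Prop} {x y : X}
    (h : FirstHit s p x y) : s.SameCycle x y := by
  obtain ⟨n, hn⟩ := h.exists_pow
  exact ⟨n, by simpa using hn⟩

end Vertices

end LabeledMap

namespace LabeledMap

variable {M : LabeledMap}

theorem rightFace_rev_back (d : M.Dart) :
    M.rightFace (M.rev (M.back d)) = M.rightFace (M.rev d) := by
  rw [← M.rightFace_next]
  exact congrArg M.rightFace (by simp [CombMap.next, M.rev_rev, rot_back])

theorem rightFace_rev_of_firstHit {p : M.Dart → Prop} {d e : M.Dart}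
    (h : FirstHit M.back p d e) : M.rightFace (M.rev e) = M.rightFace (M.rev d) := by
  induction h with
  | hit _ => exact rightFace_rev_back _
  | step _ _ ih => exact ih.trans (rightFace_rev_back _)

/-- Reversal conjugates `back` to the inverse of `next`. -/
theorem exists_back_pow_of_rightFace {d e : M.Dart}
    (h : M.rightFace (M.rev d) = M.rightFace (M.rev e)) : ∃ n : ℕ, (M.back ^ n) d = e := by
  obtain ⟨n, -, hn⟩ := (M.rightFace_eq.1 h.symm).exists_pow_eq'
  refine ⟨n, ?_⟩
  have key : ∀ n x, (M.back ^ n) (M.rev ((M.next ^ n) x)) = M.rev x := by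
    intro n
    induction n with
    | zero => exact fun _ => rfl
    | succ k ih =>
      intro x
      rw [pow_succ M.back, Equiv.Perm.mul_apply, pow_succ' M.next, Equiv.Perm.mul_apply,
        ← ih x]
      congr 1
      simp [back, CombMap.next, M.rev_rev]
  have := key n (M.rev e)
  rwa [hn, M.rev_rev, M.rev_rev] at this

/-- The smallest label of a contour has no smaller corner. -/
theorem exists_below {n : ℕ} {y : M.Dart} (h : M.label ((M.back ^ n) y) < M.label y) :
    ∃ d, M.Below y d := by
  by_contra hc
  have : ∀ n, ¬ M.label ((M.back ^ n) y) < M.label y := by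
    intro n
    induction n using Nat.strong_induction_on with
    | _ n ih =>
      intro k
      rcases Nat.eq_zero_or_pos n with rfl | h0
      · exact lt_irrefl _ k
      · exact hc ⟨_, FirstHit.of_pow h0 k fun m _ hm => ih m hm⟩
  exact this n h

open Classical in
/-- The vertex of `M`, or the face of `M` containing the new vertex, at which a dart of the
quadrangulation starts. -/
noncomputable def place (M : LabeledMap) : M.Dart × Bool → M.Vertex ⊕ M.Face
  | (d, false) => Sum.inl (M.start d)
  | (y, true) => if h : ∃ d, M.Below y d then Sum.inl (M.start h.choose)
      else Sum.inr (M.rightFace (M.rev y))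

theorem place_of_below {y d : M.Dart} (h : M.Below y d) :
    M.place (y, true) = Sum.inl (M.start d) := by
  have h' : ∃ d, M.Below y d := ⟨d, h⟩
  rw [place, dif_pos h', h'.choose_spec.unique h]

theorem place_of_not_below {y : M.Dart} (h : ¬ ∃ d, M.Below y d) :
    M.place (y, true) = Sum.inr (M.rightFace (M.rev y)) := by
  rw [place, dif_neg h]

theorem IsGentle.place_rot (hM : M.IsGentle) (z : M.Dart × Bool) :
    M.place ((M.quadrangulate hM).rot z) = M.place z := by
  rcases z with ⟨y, _ | _⟩
  · rw [quadrangulate_rot, Bool.not_false]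
    rcases le_or_gt (M.label (M.rev (M.rot y))) (M.label y) with k | k
    · rw [stepFun_top k]
      exact congrArg Sum.inl (M.start_rot y)
    · rw [stepFun_up k, place_of_below (hM.below_back_succ k)]
      rfl
  · rw [quadrangulate_rot, Bool.not_true]
    rcases lt_or_ge (M.label (M.rev y)) (M.label y) with k | k
    · rw [stepFun_desc k, place_of_below (below_back k), ← M.start_rot, rot_back]
      rfl
    · rw [stepFun_level k]
      by_cases h : ∃ d, M.Below y d
      · obtain ⟨d, hd⟩ := h
        rw [place_of_below hd, place_of_below ((hM.below_pred k).2 hd)]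
      · rw [place_of_not_below h, place_of_not_below (by simpa only [hM.below_pred k] using h),
          rightFace_rev_of_firstHit (M.firstHit_pred y)]

theorem IsGentle.sameCycle_of_rot_eq (hM : M.IsGentle) {d e : M.Dart}
    (h : M.rot.SameCycle d e) : (M.quadrangulate hM).rot.SameCycle (d, false) (e, false) := by
  obtain ⟨n, -, rfl⟩ := h.exists_pow_eq'
  clear h
  induction n with
  | zero => exact Equiv.Perm.SameCycle.refl _ _
  | succ k ih =>
    rw [pow_succ', Equiv.Perm.mul_apply]
    exact ih.trans (sameCycle_of_firstHit (hM.firstHit_rot _))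

theorem IsGentle.rot_level (hM : M.IsGentle) {y : M.Dart} (h : M.label y ≤ M.label (M.rev y)) :
    (M.quadrangulate hM).rot (y, true) = (M.pred y, true) := by
  rw [quadrangulate_rot, Bool.not_true, stepFun_level h]

theorem IsGentle.sameCycle_pred (hM : M.IsGentle) {y : M.Dart}
    (h : M.label y ≤ M.label (M.rev y)) :
    (M.quadrangulate hM).rot.SameCycle (y, true) (M.pred y, true) := by
  rw [← hM.rot_level h]
  exact (Equiv.Perm.SameCycle.refl _ _).apply_right

/-- An ascending dart starts at the vertex of the corner below its reversal. -/
theorem IsGentle.sameCycle_of_below (hM : M.IsGentle) {y d : M.Dart} (h : M.Below y d) :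
    (M.quadrangulate hM).rot.SameCycle (y, true) (d, false) := by
  -- Here `w` is the current corner of the walk and `q` is the last or next corner of level `t`:
  -- either `w` itself, or the first one ahead when `w` is higher. Successive values of `q` are
  -- related by `pred`, hence by a rotation.
  have gen : ∀ {w d : M.Dart} {t : ℤ}, FirstHit M.back (fun e => M.label e < t) w d →
      t ≤ M.label w → ∀ q, M.label q = t →
      (w = q ∨ t < M.label w ∧ FirstHit M.back (fun e => M.label e ≤ t) w q) →
      (M.quadrangulate hM).rot.SameCycle (q, true) (d, false) := by
    clear h d
    intro w d t h
    induction h with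
    | @hit w h =>
      intro hw q hq hwq
      rw [label_back] at h
      have hl := (hM.le w).1
      rcases hwq with rfl | ⟨k, -⟩
      · have e : (M.quadrangulate hM).rot (w, true) = (M.rot (M.back w), false) := by
          rw [quadrangulate_rot, Bool.not_true, stepFun_desc (by omega), rot_back]
        have h1 := (Equiv.Perm.SameCycle.refl (M.quadrangulate hM).rot (w, true)).apply_right
        rw [e] at h1
        exact h1.trans (sameCycle_of_firstHit (hM.firstHit_rot _)).symm
      · omega
    | @step w d h _ ih =>
      intro hw q hq hwq
      have hb : t ≤ M.label (M.back w) := not_lt.1 h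
      have next : ∀ q, M.label q = t → FirstHit M.back (fun e => M.label e ≤ t) w q →
          (M.quadrangulate hM).rot.SameCycle (q, true) (d, false) := by
        intro q hq k
        refine ih hb q hq ?_
        by_cases hc : M.label (M.back w) ≤ t
        · exact Or.inl (k.eq_of_hit hc).symm
        · exact Or.inr ⟨not_le.1 hc, k.of_step hc⟩
      rcases hwq with rfl | ⟨_, k⟩
      · have hr : M.label w ≤ M.label (M.rev w) := by rw [← label_back]; omega
        refine (hM.sameCycle_pred hr).trans (next _ ((hM.label_pred hr).trans hq) ?_)
        exact (M.firstHit_pred w).congr fun e => by rw [hq]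
      · exact next q hq k
  exact gen h le_rfl y rfl (Or.inl rfl)

/-- The ascending darts going to the corners of smallest label in a face start at one vertex. -/
theorem IsGentle.sameCycle_of_not_below (hM : M.IsGentle) {y z : M.Dart}
    (hy : ¬ ∃ d, M.Below y d) (hz : ¬ ∃ d, M.Below z d)
    (h : M.rightFace (M.rev y) = M.rightFace (M.rev z)) :
    (M.quadrangulate hM).rot.SameCycle (y, true) (z, true) := by
  have hmin : ∀ n, M.label y ≤ M.label ((M.back ^ n) y) := fun n =>
    not_lt.1 fun k => hy (exists_below k)
  -- The same moving marker `q`, now on a contour that never goes below the label of `y`.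
  have gen : ∀ n : ℕ, ∃ q, M.label q = M.label y ∧
      (M.quadrangulate hM).rot.SameCycle (y, true) (q, true) ∧
      ((M.back ^ n) y = q ∨ M.label y < M.label ((M.back ^ n) y) ∧
        FirstHit M.back (fun e => M.label e ≤ M.label y) ((M.back ^ n) y) q) := by
    intro n
    induction n with
    | zero => exact ⟨y, rfl, Equiv.Perm.SameCycle.refl _ _, Or.inl rfl⟩
    | succ k ih =>
      obtain ⟨q, hq, hs, hc⟩ := ih
      have hk := hmin (k + 1)
      rw [pow_succ', Equiv.Perm.mul_apply] at hk ⊢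
      generalize (M.back ^ k) y = w at *
      have next : ∀ q, FirstHit M.back (fun e => M.label e ≤ M.label y) w q →
          (M.back w = q ∨ M.label y < M.label (M.back w) ∧
            FirstHit M.back (fun e => M.label e ≤ M.label y) (M.back w) q) := by
        intro q k
        by_cases hc : M.label (M.back w) ≤ M.label y
        · exact Or.inl (k.eq_of_hit hc).symm
        · exact Or.inr ⟨not_le.1 hc, k.of_step hc⟩
      rcases hc with rfl | ⟨_, k⟩
      · have hr : M.label w ≤ M.label (M.rev w) := by rw [← label_back]; omega
        exact ⟨M.pred w, (hM.label_pred hr).trans hq, hs.trans (hM.sameCycle_pred hr),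
          next _ ((M.firstHit_pred w).congr fun e => by rw [hq])⟩
      · exact ⟨q, hq, hs, next q k⟩
  obtain ⟨n, rfl⟩ := exists_back_pow_of_rightFace h
  obtain ⟨m, hm⟩ := exists_back_pow_of_rightFace h.symm
  -- Both corners attain the minimum of the contour, so the marker has stopped exactly at the second
  -- one.
  have hl : M.label ((M.back ^ n) y) ≤ M.label y := by
    refine not_lt.1 fun k => hz (exists_below (n := m) ?_)
    rwa [hm]
  obtain ⟨q, -, hs, rfl | ⟨k, -⟩⟩ := gen n
  · exact hs
  · omega

/-- The vertices of the quadrangulation are the vertices and the faces of `M`. -/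
noncomputable def IsGentle.vertexPlace (hM : M.IsGentle) :
    (M.quadrangulate hM).Vertex → M.Vertex ⊕ M.Face :=
  Quotient.lift M.place (by
    intro a b h
    obtain ⟨n, -, rfl⟩ :=
      Equiv.Perm.SameCycle.exists_pow_eq' (f := (M.quadrangulate hM).rot) h
    clear h
    induction n with
    | zero => rfl
    | succ k ih =>
      rw [pow_succ', Equiv.Perm.mul_apply]
      exact ih.trans (hM.place_rot _).symm)

theorem IsGentle.vertexPlace_start (hM : M.IsGentle) (z : M.Dart × Bool) :
    hM.vertexPlace ((M.quadrangulate hM).start z) = M.place z := rfl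

theorem IsGentle.exists_start_of_inl (hM : M.IsGentle) {z : M.Dart × Bool} {v : M.Vertex}
    (h : M.place z = Sum.inl v) :
    ∃ d, M.start d = v ∧ (M.quadrangulate hM).rot.SameCycle z (d, false) := by
  rcases z with ⟨y, _ | _⟩
  · exact ⟨y, Sum.inl_injective h, Equiv.Perm.SameCycle.refl _ _⟩
  · by_cases hb : ∃ d, M.Below y d
    · obtain ⟨d, hd⟩ := hb
      rw [place_of_below hd] at h
      exact ⟨d, Sum.inl_injective h, hM.sameCycle_of_below hd⟩
    · rw [place_of_not_below hb] at h
      cases h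

theorem exists_of_place_inr {z : M.Dart × Bool} {f : M.Face}
    (h : M.place z = Sum.inr f) :
    ∃ y, z = (y, true) ∧ (¬ ∃ d, M.Below y d) ∧ M.rightFace (M.rev y) = f := by
  rcases z with ⟨y, _ | _⟩
  · cases h
  · by_cases hb : ∃ d, M.Below y d
    · obtain ⟨d, hd⟩ := hb
      rw [place_of_below hd] at h
      cases h
    · rw [place_of_not_below hb] at h
      exact ⟨y, rfl, hb, Sum.inr_injective h⟩

theorem IsGentle.vertexPlace_injective (hM : M.IsGentle) :
    Function.Injective hM.vertexPlace := by
  intro v w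
  obtain ⟨x, rfl⟩ := Quotient.exists_rep v
  obtain ⟨y, rfl⟩ := Quotient.exists_rep w
  intro h
  change M.place x = M.place y at h
  refine (M.quadrangulate hM).start_eq.2 ?_
  rcases hy : M.place y with v | f
  · obtain ⟨d, hd, hxd⟩ := hM.exists_start_of_inl (h.trans hy)
    obtain ⟨e, he, hye⟩ := hM.exists_start_of_inl hy
    exact hxd.trans ((hM.sameCycle_of_rot_eq (M.start_eq.1 (hd.trans he.symm))).trans hye.symm)
  · obtain ⟨d, rfl, hd, hdf⟩ := exists_of_place_inr (h.trans hy)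
    obtain ⟨e, rfl, he, hef⟩ := exists_of_place_inr hy
    exact hM.sameCycle_of_not_below hd he (hdf.trans hef.symm)

theorem IsGentle.vertexPlace_surjective (hM : M.IsGentle) :
    Function.Surjective hM.vertexPlace := by
  rintro (v | f)
  · obtain ⟨d, rfl⟩ := Quotient.exists_rep v
    exact ⟨(M.quadrangulate hM).start (d, false), rfl⟩
  · obtain ⟨d, rfl⟩ := Quotient.exists_rep f
    -- A corner of least label on the contour has no smaller corner, so its edge goes to the new
    -- vertex.
    obtain ⟨y, hy, hmin⟩ := Set.exists_min_image
      {y | M.rightFace (M.rev y) = M.rightFace d} M.label (Set.toFinite _)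
      ⟨M.rev d, congrArg M.rightFace (M.rev_rev d)⟩
    refine ⟨(M.quadrangulate hM).start (y, true), ?_⟩
    rw [vertexPlace_start, place_of_not_below]
    · exact congrArg Sum.inr hy
    · rintro ⟨e, he⟩
      exact absurd he.holds (not_lt.2 (hmin e ((rightFace_rev_of_firstHit he).trans hy)))

noncomputable def IsGentle.vertexEquiv (hM : M.IsGentle) :
    (M.quadrangulate hM).Vertex ≃ M.Vertex ⊕ M.Face :=
  Equiv.ofBijective _ ⟨hM.vertexPlace_injective, hM.vertexPlace_surjective⟩

end LabeledMap

/-! ### Connectedness by rotations and reversals. -/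

namespace CombMap

variable (M : CombMap)

/-- Two darts are related by a sequence of rotations and reversals. -/
def Joined (d e : M.Dart) : Prop := ∃ g ∈ Subgroup.closure {M.rot, M.rev}, g d = e

variable {M}

theorem Joined.refl (d : M.Dart) : M.Joined d d := ⟨1, one_mem _, rfl⟩

theorem Joined.symm {d e : M.Dart} (h : M.Joined d e) : M.Joined e d := by
  obtain ⟨g, hg, rfl⟩ := h
  exact ⟨g⁻¹, inv_mem hg, by simp⟩

theorem Joined.trans {d e f : M.Dart} (h : M.Joined d e) (k : M.Joined e f) : M.Joined d f := by
  obtain ⟨g, hg, rfl⟩ := h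
  obtain ⟨g', hg', rfl⟩ := k
  exact ⟨g' * g, mul_mem hg' hg, rfl⟩

theorem joined_rot (d : M.Dart) : M.Joined d (M.rot d) :=
  ⟨M.rot, Subgroup.subset_closure (Or.inl rfl), rfl⟩

theorem joined_rev (d : M.Dart) : M.Joined d (M.rev d) :=
  ⟨M.rev, Subgroup.subset_closure (Or.inr rfl), rfl⟩

theorem joined_next (d : M.Dart) : M.Joined d (M.next d) :=
  (joined_rev d).trans (joined_rot _)

theorem joined_of_sameCycle {d e : M.Dart} (h : M.rot.SameCycle d e) : M.Joined d e := by
  obtain ⟨n, rfl⟩ := h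
  exact ⟨M.rot ^ n, Subgroup.zpow_mem _ (Subgroup.subset_closure (Set.mem_insert _ _)) n, rfl⟩

/-- Reduces later connectedness arguments to the two generators. -/
theorem rel_of_joined {r : M.Dart → M.Dart → Prop} (hr : Equivalence r)
    (h1 : ∀ d, r d (M.rot d)) (h2 : ∀ d, r d (M.rev d)) {d e : M.Dart} (h : M.Joined d e) :
    r d e := by
  obtain ⟨g, hg, rfl⟩ := h
  induction hg using Subgroup.closure_induction generalizing d with
  | mem x hx =>
    rcases hx with rfl | rfl
    · exact h1 d
    · exact h2 d
  | one => exact hr.refl _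
  | mul x y _ _ hx hy => exact hr.trans hy hx
  | inv x _ hx => simpa using hr.symm (hx (d := x⁻¹ d))

end CombMap

/-! ### Connectedness, Euler characteristic and statistics of the quadrangulation. -/

namespace LabeledMap

variable {M : LabeledMap}

theorem joined_back (d : M.Dart) : M.Joined d (M.back d) := by
  have h := CombMap.joined_rot (M := M.toCombMap) (M.back d)
  rw [rot_back] at h
  exact (CombMap.joined_rev d).trans h.symm

theorem joined_of_firstHit {p : M.Dart → Prop} {d e : M.Dart} (h : FirstHit M.back p d e) :
    M.Joined d e := by
  induction h with
  | hit _ => exact joined_back _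
  | step _ _ ih => exact (joined_back _).trans ih

/-- A rotation in the quadrangulation moves the first component by a rotation, a reversal or a walk
along a contour of `M`. -/
theorem IsGentle.joined_fst (hM : M.IsGentle) {z w : M.Dart × Bool}
    (h : (M.quadrangulate hM).Joined z w) : M.Joined z.1 w.1 := by
  refine CombMap.rel_of_joined (M := (M.quadrangulate hM).toCombMap)
    (r := fun z w => M.Joined (Prod.fst z) (Prod.fst w))
    ⟨fun _ => .refl _, .symm, .trans⟩ ?_ ?_ h
  · rintro ⟨y, _ | _⟩
    · rw [quadrangulate_rot, Bool.not_false]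
      rcases le_or_gt (M.label (M.rev (M.rot y))) (M.label y) with k | k
      · rw [stepFun_top k]
        exact CombMap.joined_rot _
      · rw [stepFun_up k]
        refine CombMap.Joined.trans (CombMap.Joined.symm ?_) (joined_back _)
        have := joined_of_firstHit (M.firstHit_pred (M.succ y))
        rwa [M.pred_succ (hM.label_succ k).1] at this
    · rw [quadrangulate_rot, Bool.not_true]
      rcases lt_or_ge (M.label (M.rev y)) (M.label y) with k | k
      · rw [stepFun_desc k]
        exact CombMap.joined_rev _
      · rw [stepFun_level k]
        exact joined_of_firstHit (M.firstHit_pred y)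
  · rintro ⟨y, b⟩
    exact .refl _

/-- The darts `(d, false)` and `(rev d, false)` lie in the same face, one or two steps apart. -/
theorem IsGentle.joined_rev_false (hM : M.IsGentle) (d : M.Dart) :
    (M.quadrangulate hM).Joined (d, false) (M.rev d, false) := by
  have next : ∀ z w : M.Dart × Bool, M.stepFun z = w → (M.quadrangulate hM).Joined z w := by
    rintro z _ rfl
    rw [← quadrangulate_next hM]
    exact CombMap.joined_next (M := (M.quadrangulate hM).toCombMap) z
  rcases lt_trichotomy (M.label d) (M.label (M.rev d)) with h | h | h
  · refine (next _ _ ?_).symm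
    rw [stepFun_desc, M.rev_rev]
    rwa [M.rev_rev]
  · refine (next _ (M.back d, true) ?_).trans (next _ _ ?_)
    · rw [stepFun_level h.le, M.pred_of_le h.ge]
    · exact stepFun_back h.le
  · exact next _ _ (stepFun_desc h)

theorem IsGentle.joined_false (hM : M.IsGentle) {d e : M.Dart} (h : M.Joined d e) :
    (M.quadrangulate hM).Joined (d, false) (e, false) :=
  CombMap.rel_of_joined
    (r := fun d e => (M.quadrangulate hM).Joined (d, false) (e, false))
    ⟨fun _ => .refl _, .symm, .trans⟩
    (fun d => CombMap.joined_of_sameCycle (sameCycle_of_firstHit (hM.firstHit_rot d)))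
    (hM.joined_rev_false) h

theorem IsGentle.isConnected_quadrangulate (hM : M.IsGentle) :
    (M.quadrangulate hM).IsConnected ↔ M.IsConnected := by
  have start : ∀ z : M.Dart × Bool, (M.quadrangulate hM).Joined z (z.1, false) := by
    rintro ⟨d, _ | _⟩
    · exact .refl _
    · exact CombMap.joined_rev (M := (M.quadrangulate hM).toCombMap) (d, true)
  exact ⟨fun h d e => hM.joined_fst (h (d, false) (e, false)),
    fun h z w => (start z).trans ((hM.joined_false (h _ _)).trans (start w).symm)⟩

/-- Double counting: the `2 * (2E)` darts of the quadrangulation come in pairs along edges and in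
fours around faces. -/
theorem IsGentle.card_edge (hM : M.IsGentle) :
    Nat.card M.Edge = Nat.card (M.quadrangulate hM).Face ∧
      Nat.card (M.quadrangulate hM).Edge = 2 * Nat.card M.Edge := by
  have h1 := M.card_dart_eq_edge
  have h2 := (M.quadrangulate hM).card_dart_eq_edge
  have h3 := CombMap.card_dart_eq_face _ (quadrangulate_isQuadrangular hM)
  have h4 : Nat.card (M.quadrangulate hM).Dart = Nat.card M.Dart * 2 := by
    change Nat.card (M.Dart × Bool) = _
    simp [Nat.card_prod]
  omega

theorem IsGentle.isPlanarMap_quadrangulate (hM : M.IsGentle) :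
    (M.quadrangulate hM).IsPlanarMap ↔ M.IsPlanarMap := by
  have hv : Nat.card (M.quadrangulate hM).Vertex = Nat.card M.Vertex + Nat.card M.Face := by
    rw [Nat.card_congr hM.vertexEquiv, Nat.card_sum]
  obtain ⟨h1, h2⟩ := hM.card_edge
  refine and_congr hM.isConnected_quadrangulate ?_
  omega

/-- A vertex inherited from `M` has a descending dart; a vertex created in a face has only ascending
ones. -/
theorem IsGentle.isLocalMin_quadrangulate (hM : M.IsGentle) (v : (M.quadrangulate hM).Vertex) :
    (M.quadrangulate hM).IsLocalMin v ↔ ∃ f, hM.vertexEquiv v = Sum.inr f := by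
  constructor
  · intro h
    rcases hv : hM.vertexEquiv v with u | f
    · obtain ⟨d, rfl⟩ := Quotient.exists_rep u
      have e : (M.quadrangulate hM).start (d, false) = v := hM.vertexEquiv.injective hv.symm
      have := h (d, false) e
      subst e
      change M.label d ≤ M.label d - 1 at this
      omega
    · exact ⟨f, rfl⟩
  · rintro ⟨f, hf⟩ z rfl
    obtain ⟨y, rfl, -⟩ := exists_of_place_inr hf
    change M.label y - 1 ≤ M.label y
    omega

theorem IsGentle.card_face (hM : M.IsGentle) :
    Nat.card M.Face = Nat.card {v // (M.quadrangulate hM).IsLocalMin v} := by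
  refine Nat.card_congr (Equiv.ofBijective
    (fun f => ⟨hM.vertexEquiv.symm (Sum.inr f),
      (hM.isLocalMin_quadrangulate _).2 ⟨f, by simp⟩⟩) ⟨fun f g h => ?_, ?_⟩)
  · exact Sum.inr_injective (hM.vertexEquiv.symm.injective (Subtype.ext_iff.1 h))
  · rintro ⟨v, hv⟩
    obtain ⟨f, hf⟩ := (hM.isLocalMin_quadrangulate v).1 hv
    exact ⟨f, Subtype.ext (by simp [← hf])⟩

/-- A rising edge `rot e` of `M` forces an ascending dart just after `(e, false)`; without rising
edges, rotation runs through descending darts only. -/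
theorem IsGentle.isLocalMax_quadrangulate (hM : M.IsGentle) (d : M.Dart) :
    (M.quadrangulate hM).IsLocalMax ((M.quadrangulate hM).start (d, false)) ↔
      M.IsLocalMax (M.start d) := by
  constructor
  · intro h e he
    obtain ⟨e, rfl⟩ := M.rot.surjective e
    rw [M.start_rot] at he
    by_contra hc
    rw [← he, not_le] at hc
    have hs : (M.quadrangulate hM).start ((M.quadrangulate hM).rot (e, false)) =
        (M.quadrangulate hM).start (d, false) := by
      refine ((M.quadrangulate hM).start_rot _).trans ?_
      exact (M.quadrangulate hM).start_eq.2 (hM.sameCycle_of_rot_eq (M.start_eq.1 he))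
    have hr : (M.quadrangulate hM).rot (e, false) = (M.back (M.succ e), true) := stepFun_up hc
    rw [hr] at hs
    have := h _ hs
    rw [← hs] at this
    change M.label (M.back (M.succ e)) ≤ M.label (M.back (M.succ e)) - 1 at this
    omega
  · intro h z hz
    obtain ⟨n, -, rfl⟩ := ((M.quadrangulate hM).start_eq.1 hz).symm.exists_pow_eq'
    have gen : ∀ n : ℕ, ∃ e, M.start e = M.start d ∧
        ((M.quadrangulate hM).rot ^ n) (d, false) = (e, false) := by
      intro n
      induction n with
      | zero => exact ⟨d, rfl, rfl⟩
      | succ k ih =>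
        obtain ⟨e, he, hk⟩ := ih
        refine ⟨M.rot e, (M.start_rot e).trans he, ?_⟩
        rw [pow_succ']
        refine (congrArg (M.quadrangulate hM).rot hk).trans (stepFun_top ?_)
        have := h (M.rot e) ((M.start_rot e).trans he)
        rw [← he] at this
        exact this
    obtain ⟨e, -, hn⟩ := gen n
    rw [← hz, hn]
    change M.label e - 1 ≤ M.label e
    omega

theorem IsGentle.card_localMax (hM : M.IsGentle) :
    Nat.card {v // M.IsLocalMax v} = Nat.card {v // (M.quadrangulate hM).IsLocalMax v} := by
  have hs : ∀ d, hM.vertexEquiv.symm (Sum.inl (M.start d)) =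
      (M.quadrangulate hM).start (d, false) := fun d => hM.vertexEquiv.symm_apply_eq.2 rfl
  have hmax : ∀ v, M.IsLocalMax v →
      (M.quadrangulate hM).IsLocalMax (hM.vertexEquiv.symm (Sum.inl v)) := by
    intro v
    obtain ⟨d, rfl⟩ := Quotient.exists_rep v
    intro h
    have := (hM.isLocalMax_quadrangulate d).2 h
    rwa [← hs] at this
  refine Nat.card_congr (Equiv.ofBijective
    (fun v => ⟨hM.vertexEquiv.symm (Sum.inl v.1), hmax _ v.2⟩) ⟨fun f g h => ?_, ?_⟩)
  · exact Subtype.ext (Sum.inl_injective (hM.vertexEquiv.symm.injective (Subtype.ext_iff.1 h)))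
  · rintro ⟨v, hv⟩
    obtain ⟨⟨d, b⟩, rfl⟩ := Quotient.exists_rep v
    cases b
    · exact ⟨⟨M.start d, (hM.isLocalMax_quadrangulate d).1 hv⟩, Subtype.ext (hs d)⟩
    -- An ascending dart cannot start at a local maximum.
    · have := hv (d, true) rfl
      change M.label d ≤ M.label d - 1 at this
      omega

theorem IsGentle.exists_greatest (hM : M.IsGentle) :
    ∃ t, IsGreatest (Set.range (M.quadrangulate hM).vertexLabel) t ∧
      IsGreatest (Set.range M.vertexLabel) t := by
  have : Nonempty M.Dart := ⟨M.root⟩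
  obtain ⟨d, hd⟩ := Finite.exists_max M.label
  refine ⟨M.label d, ⟨⟨(M.quadrangulate hM).start (d, false), rfl⟩, ?_⟩, ⟨M.start d, rfl⟩, ?_⟩
  · rintro _ ⟨v, rfl⟩
    obtain ⟨⟨e, b⟩, rfl⟩ := Quotient.exists_rep v
    have := hd e
    cases b
    · exact this
    · change M.label e - 1 ≤ _
      omega
  · rintro _ ⟨v, rfl⟩
    obtain ⟨e, rfl⟩ := Quotient.exists_rep v
    exact hd e

theorem IsGentle.exists_least (hM : M.IsGentle) :
    ∃ t, IsLeast (Set.range (M.quadrangulate hM).vertexLabel) t ∧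
      IsLeast (Set.range M.vertexLabel) (t + 1) := by
  have : Nonempty M.Dart := ⟨M.root⟩
  obtain ⟨d, hd⟩ := Finite.exists_min M.label
  refine ⟨M.label d - 1, ⟨⟨(M.quadrangulate hM).start (d, true), rfl⟩, ?_⟩,
    ⟨M.start d, (sub_add_cancel _ _).symm⟩, ?_⟩
  · rintro _ ⟨v, rfl⟩
    obtain ⟨⟨e, b⟩, rfl⟩ := Quotient.exists_rep v
    have := hd e
    cases b
    · change _ ≤ M.label e
      omega
    · change _ ≤ M.label e - 1
      omega
  · rintro _ ⟨v, rfl⟩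
    obtain ⟨e, rfl⟩ := Quotient.exists_rep v
    rw [sub_add_cancel]
    exact hd e

end LabeledMap

/-! ### Coloured darts are the descending darts. -/

namespace LabeledQuad

variable {Q : LabeledQuad}

theorem label_rev_of_coloured {c c' : Q.Dart} (h : Q.Coloured c c') :
    Q.label (Q.rev c) < Q.label c := by
  have h0 : Q.label (Q.next c) = Q.label (Q.rev c) := Q.label_rot (Q.rev c)
  rcases h with ⟨⟨h1, -, -⟩, -⟩ | ⟨⟨h1, h2, -⟩, rfl⟩ | ⟨⟨h1, -, -⟩, -⟩ <;> omega

/-- The corners containing an end of a coloured edge are those to the right of the descending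
darts. -/
theorem exists_coloured_iff {c : Q.Dart} :
    (∃ c', Q.Coloured c c') ↔ Q.label (Q.rev c) < Q.label c :=
  ⟨fun ⟨_, h⟩ => label_rev_of_coloured h, Q.exists_coloured c⟩

theorem coloured_otherEnd (c : Q.ColouredDart) : Q.Coloured c.1 (Q.otherEnd c).1 :=
  Classical.choose_spec c.2

theorem otherEnd_eq {c c' : Q.ColouredDart} (h : Q.Coloured c.1 c'.1) : Q.otherEnd c = c' :=
  Subtype.ext ((coloured_otherEnd c).unique h)

theorem colouredMap_isGentle (Q : LabeledQuad) : Q.colouredMap.IsGentle := by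
  intro c
  change |Q.label (Q.otherEnd c).1 - Q.label c.1| ≤ 1
  rw [abs_le]
  rcases coloured_otherEnd c with ⟨⟨h1, -, -⟩, h⟩ | ⟨⟨h1, -, -⟩, h⟩ | ⟨⟨-, h2, -⟩, h⟩
  · rw [← h] at h1; omega
  · rw [← h] at h1; omega
  · rw [← h] at h2; omega

theorem label_rev_eq (d : Q.Dart) :
    Q.label (Q.rev d) = Q.label d - 1 ∨ Q.label (Q.rev d) = Q.label d + 1 := by
  have := Q.label_rev d
  rw [abs_eq one_pos.le] at this
  omega

/-- Reversal as a descending dart. -/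
theorem coloured_rev {d : Q.Dart} (h : ¬ ∃ c', Q.Coloured d c') :
    ∃ c', Q.Coloured (Q.rev d) c' := by
  rw [exists_coloured_iff] at h ⊢
  rw [Q.rev_rev]
  have := label_rev_eq d
  omega

theorem not_coloured_rev {d : Q.Dart} (h : ∃ c', Q.Coloured d c') :
    ¬ ∃ c', Q.Coloured (Q.rev d) c' := by
  rw [exists_coloured_iff] at h ⊢
  rw [Q.rev_rev]
  omega

theorem firstHit_colouredMap_rot (c : Q.ColouredDart) :
    FirstHit Q.rot (fun c => ∃ c', Q.Coloured c c') c.1 (Q.colouredMap.rot c).1 :=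
  FirstHit.firstReturn Q.rot _ c

/-- A corner of the coloured graph that directly follows a descending dart. -/
theorem colouredMap_rot_eq {c d : Q.ColouredDart} (h : Q.rot c.1 = d.1) :
    Q.colouredMap.rot c = d :=
  Subtype.ext (((firstHit_colouredMap_rot c).eq_of_hit (by rw [h]; exact d.2)).trans h)

end LabeledQuad

namespace LabeledMap

theorem isGentle_toLabeledMap (M : LabeledPlanarMap) : M.toLabeledMap.IsGentle := M.label_rev

end LabeledMap

/-! ### The coloured map of the quadrangulation of `M` is `M`. -/

namespace LabeledPlanarMap

/-- The labeled quadrangulation associated with a labeled planar map. -/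
noncomputable def toQuad (M : LabeledPlanarMap) : LabeledQuad where
  toLabeledMap := M.toLabeledMap.quadrangulate (LabeledMap.isGentle_toLabeledMap M)
  planar := (LabeledMap.isGentle_toLabeledMap M).isPlanarMap_quadrangulate.2 M.planar
  quad := LabeledMap.quadrangulate_isQuadrangular (LabeledMap.isGentle_toLabeledMap M)
  label_rev := LabeledMap.quadrangulate_label_rev (LabeledMap.isGentle_toLabeledMap M)

variable (M : LabeledPlanarMap)

theorem toQuad_coloured_iff (z : M.Dart × Bool) :
    (∃ c, M.toQuad.Coloured z c) ↔ z.2 = false := by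
  refine LabeledQuad.exists_coloured_iff.trans ?_
  rcases z with ⟨d, _ | _⟩
  · change M.label d - 1 < M.label d ↔ _
    simp
  · change M.label d < M.label d - 1 ↔ _
    simp

/-- The darts of `M` are the coloured darts of the associated quadrangulation. -/
def colouredEquiv : M.Dart ≃ M.toQuad.ColouredDart where
  toFun d := ⟨(d, false), (M.toQuad_coloured_iff _).2 rfl⟩
  invFun c := Prod.fst (α := M.Dart) (β := Bool) c.1
  left_inv _ := rfl
  right_inv := by
    rintro ⟨⟨d, b⟩, h⟩
    obtain rfl : b = false := (M.toQuad_coloured_iff (d, b)).1 h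
    rfl

theorem colouredEquiv_rot (d : M.Dart) :
    M.colouredEquiv (M.rot d) = M.toQuad.colouredMap.rot (M.colouredEquiv d) := by
  have h := ((LabeledMap.isGentle_toLabeledMap M).firstHit_rot d).congr
    fun z => (M.toQuad_coloured_iff z).symm
  exact Subtype.ext (h.unique (LabeledQuad.firstHit_colouredMap_rot (M.colouredEquiv d)))

/-- The face enclosing the edge `d` is simple or confluent according to the labels of its ends, and
its explicit cycle under `stepFun` places the coloured edge along `d`. -/
theorem coloured_rev_false (d : M.Dart) : M.toQuad.Coloured (d, false) (M.rev d, false) := by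
  have hM := LabeledMap.isGentle_toLabeledMap M
  have hn : ∀ z w : M.Dart × Bool, M.toLabeledMap.stepFun z = w → M.toQuad.next z = w :=
    fun z w h => (LabeledMap.quadrangulate_next hM z).trans h
  have top : ∀ d, M.label (M.rev d) < M.label d →
      M.toQuad.SimpleTop (d, false) ∧ M.toQuad.next (d, false) = (M.rev d, false) := by
    intro d h
    have hl := (hM.le d).1
    have h' : M.label (M.rev d) < M.label (M.rev (M.rev d)) := by rwa [M.rev_rev]
    have n1 := hn _ _ (LabeledMap.stepFun_desc h)
    have n2 := hn _ _ (LabeledMap.stepFun_level h'.le)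
    have n3 := hn _ _ (hM.stepFun_pred h')
    refine ⟨⟨?_, ?_, ?_⟩, n1⟩
    · rw [n1]
      change M.label (M.rev d) = M.label d - 1
      omega
    · rw [n1, n2]
      change M.label (M.toLabeledMap.pred (M.rev d)) - 1 = M.label d - 2
      rw [hM.label_pred h'.le]
      omega
    · rw [n1, n2, n3]
      change M.label (M.toLabeledMap.back (M.rev d)) - 1 = M.label d - 1
      rw [LabeledMap.label_back, M.rev_rev]
  rcases lt_trichotomy (M.label (M.rev d)) (M.label d) with h | h | h
  · obtain ⟨h1, h2⟩ := top d h
    exact Or.inl ⟨h1, h2.symm⟩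
  · have n1 := hn _ _ (LabeledMap.stepFun_level h.ge)
    rw [M.toLabeledMap.pred_of_le h.le] at n1
    have n2 := hn _ _ (LabeledMap.stepFun_back h.ge)
    have n3 := hn (M.rev d, false) _
      (LabeledMap.stepFun_level (M := M.toLabeledMap) (d := M.rev d) (by rw [M.rev_rev, h]))
    rw [M.toLabeledMap.pred_of_le (by rw [M.rev_rev, h])] at n3
    refine Or.inr (Or.inr ⟨⟨?_, ?_, ?_⟩, ?_⟩)
    · rw [n1]
      change M.label (M.toLabeledMap.back d) - 1 = M.label d - 1
      rw [LabeledMap.label_back, h]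
    · rw [n1, n2]
      exact h
    · rw [n1, n2, n3]
      change M.label (M.toLabeledMap.back (M.rev d)) - 1 = M.label d - 1
      rw [LabeledMap.label_back, M.rev_rev]
    · rw [n1, n2]
  · obtain ⟨h1, h2⟩ := top (M.rev d) (by rwa [M.rev_rev])
    rw [M.rev_rev] at h2
    exact Or.inr (Or.inl ⟨h1, h2.symm⟩)

theorem colouredEquiv_rev (d : M.Dart) :
    M.colouredEquiv (M.rev d) = M.toQuad.otherEnd (M.colouredEquiv d) :=
  (LabeledQuad.otherEnd_eq (M.coloured_rev_false d)).symm

theorem isIso_colouredEquiv :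
    LabeledMap.IsIso M.toLabeledMap M.toQuad.colouredMap M.colouredEquiv :=
  ⟨M.colouredEquiv_rot, M.colouredEquiv_rev, fun _ => rfl⟩

theorem colouredEquiv_root : M.colouredEquiv M.root = M.toQuad.colouredMap.root := by
  have ht : M.toQuad.topColoured = M.colouredEquiv (M.toLabeledMap.back M.root) := by
    -- The marked dart of `toQuad` is already descending, so `topRoot` keeps it.
    refine Subtype.ext (if_pos ?_)
    exact LabeledQuad.exists_coloured_iff.1 ((M.toQuad_coloured_iff _).2 rfl)
  change _ = M.toQuad.otherEnd (M.toQuad.colouredMap.rot M.toQuad.topColoured)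
  rw [ht, ← colouredEquiv_rot, ← colouredEquiv_rev, LabeledMap.rot_back, M.rev_rev]

end LabeledPlanarMap

/-! ### A quadrangulation is recovered from its coloured map. -/

namespace LabeledQuad

variable {Q : LabeledQuad}

theorem next_rev (d : Q.Dart) : Q.next (Q.rev d) = Q.rot d := congrArg Q.rot (Q.rev_rev d)

theorem rot_rev (d : Q.Dart) : Q.rot (Q.rev d) = Q.next d := rfl

theorem simpleTop_of_lt {c : Q.colouredMap.Dart}
    (h : Q.label (Q.colouredMap.rev c).1 < Q.label c.1) :
    Q.SimpleTop c.1 ∧ Q.next c.1 = (Q.colouredMap.rev c).1 := by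
  rcases coloured_otherEnd c with ⟨h1, h2⟩ | ⟨⟨h1, -, -⟩, h2⟩ | ⟨⟨-, h1, -⟩, h2⟩
  · exact ⟨h1, h2.symm⟩
  · change Q.label (Q.otherEnd c).1 < _ at h
    rw [← h2] at h1
    omega
  · change Q.label (Q.otherEnd c).1 < _ at h
    rw [← h2] at h1
    omega

theorem next_next_of_eq {c : Q.colouredMap.Dart}
    (h : Q.label (Q.colouredMap.rev c).1 = Q.label c.1) :
    Q.ConfluentTop c.1 ∧ Q.next (Q.next c.1) = (Q.colouredMap.rev c).1 := by
  rcases coloured_otherEnd c with ⟨⟨h1, -, -⟩, h2⟩ | ⟨⟨h1, -, -⟩, h2⟩ | ⟨h1, h2⟩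
  · change Q.label (Q.otherEnd c).1 = _ at h
    rw [← h2] at h1
    omega
  · change Q.label (Q.otherEnd c).1 = _ at h
    rw [← h2] at h1
    omega
  · exact ⟨h1, h2.symm⟩

/-- A corner of largest label in its face directly follows a descending dart. -/
theorem rot_symm_of_top {c : Q.colouredMap.Dart}
    (h : Q.label (Q.colouredMap.rev c).1 ≤ Q.label c.1) :
    Q.rot (Q.colouredMap.rot.symm c).1 = c.1 := by
  have h3 : Q.label (Q.next (Q.next (Q.next c.1))) = Q.label c.1 - 1 := by
    rcases h.lt_or_eq with h | h
    · exact (simpleTop_of_lt h).1.2.2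
    · exact (next_next_of_eq h).1.2.2
  have hr : Q.rot (Q.rev (Q.next (Q.next (Q.next c.1)))) = c.1 := Q.next_four Q.quad c.1
  have hl : Q.label (Q.rev (Q.next (Q.next (Q.next c.1)))) = Q.label c.1 := by
    rw [← Q.label_rot, hr]
  have hd : ∃ c', Q.Coloured (Q.rev (Q.next (Q.next (Q.next c.1)))) c' := by
    rw [exists_coloured_iff, Q.rev_rev]
    omega
  have e : Q.colouredMap.rot.symm c = ⟨_, hd⟩ :=
    (Equiv.symm_apply_eq _).2 (colouredMap_rot_eq (d := c) hr).symm
  rw [e]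
  exact hr

theorem rot_back {d : Q.colouredMap.Dart} (h : Q.label d.1 ≤ Q.label (Q.colouredMap.rev d).1) :
    Q.rot (Q.colouredMap.back d).1 = (Q.colouredMap.rev d).1 :=
  rot_symm_of_top (c := Q.colouredMap.rev d) (by rwa [Q.colouredMap.rev_rev])

theorem next_of_confluent {d : Q.colouredMap.Dart}
    (h : Q.label (Q.colouredMap.rev d).1 = Q.label d.1) :
    Q.next d.1 = Q.rev (Q.colouredMap.back d).1 := by
  have h1 := rot_back h.ge
  rw [← (next_next_of_eq h).2, ← rot_rev (Q.next d.1)] at h1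
  rw [Q.rot.injective h1, Q.rev_rev]

theorem next_next_of_mid {d : Q.colouredMap.Dart}
    (h : Q.label d.1 < Q.label (Q.colouredMap.rev d).1) :
    Q.next (Q.next d.1) = Q.rev (Q.colouredMap.back d).1 := by
  have h1 := rot_back h.le
  have h2 := (simpleTop_of_lt (c := Q.colouredMap.rev d) (by rwa [Q.colouredMap.rev_rev])).2
  rw [Q.colouredMap.rev_rev] at h2
  have h3 := Q.next_four Q.quad (Q.colouredMap.rev d).1
  rw [h2] at h3
  rw [← h3, ← rot_rev (Q.next (Q.next d.1))] at h1
  rw [Q.rot.injective h1, Q.rev_rev]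

/-- After the corner `d` of a simple face comes its lowest corner, from which the next side ascends;
`x` is the reversal of that side. -/
theorem exists_next_of_mid {d : Q.colouredMap.Dart}
    (h : Q.label d.1 < Q.label (Q.colouredMap.rev d).1) :
    ∃ x : Q.colouredMap.Dart, Q.next d.1 = Q.rev x.1 ∧ Q.rot x.1 = Q.rev (Q.colouredMap.back d).1 := by
  have h2 := (simpleTop_of_lt (c := Q.colouredMap.rev d) (by rwa [Q.colouredMap.rev_rev]))
  rw [Q.colouredMap.rev_rev] at h2
  obtain ⟨⟨h3, h4, -⟩, h5⟩ := h2
  rw [h5] at h3 h4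
  have hx : ¬ ∃ c', Q.Coloured (Q.next d.1) c' := by
    intro hc
    obtain ⟨c', hc⟩ := hc
    have h6 := label_rev_of_coloured hc
    have h7 := Q.label_rot (Q.rev (Q.next d.1))
    rw [rot_rev, next_next_of_mid h] at h7
    have h8 := exists_coloured_iff.1 (Q.colouredMap.back d).2
    have h9 := Q.colouredMap.label_back d
    change Q.label (Q.colouredMap.back d).1 = Q.label (Q.colouredMap.rev d).1 at h9
    rcases label_rev_eq (Q.colouredMap.back d).1 with h10 | h10 <;> omega
  refine ⟨⟨Q.rev (Q.next d.1), coloured_rev hx⟩, (Q.rev_rev _).symm, ?_⟩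
  exact next_next_of_mid h

/-- `d.Below x`: the dart `x` is the last descending dart before the reversal of `d` around the
end point of `d`. -/
def Below (y x : Q.colouredMap.Dart) : Prop :=
  FirstHit Q.rot.symm (fun c => ∃ c', Q.Coloured c c') (Q.rev y.1) x.1

theorem Below.label {y x : Q.colouredMap.Dart} (h : Below y x) : Q.label x.1 = Q.label y.1 - 1 := by
  have gen : ∀ {a b : Q.Dart} {p : Q.Dart → Prop}, FirstHit Q.rot.symm p a b →
      Q.label b = Q.label a := by
    intro a b p h
    induction h with
    | hit _ => rw [← Q.label_rot, Equiv.apply_symm_apply]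
    | step _ _ ih => rw [ih, ← Q.label_rot, Equiv.apply_symm_apply]
  have h1 := exists_coloured_iff.1 y.2
  have h2 := label_rev_eq y.1
  rw [gen h]
  omega

theorem below_of_rot {y x : Q.colouredMap.Dart} (h : Q.rot x.1 = Q.rev y.1) : Below y x := by
  have e : Q.rot.symm (Q.rev y.1) = x.1 := by rw [← h, Equiv.symm_apply_apply]
  have := FirstHit.hit (s := Q.rot.symm) (p := fun c => ∃ c', Q.Coloured c c') (x := Q.rev y.1)
    (by rw [e]; exact x.2)
  rwa [e] at this

/-- The hypothesis `k` makes `rev y` and `rev e` consecutive around a vertex, with no descending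
dart between them. -/
theorem Below.of_next {y e x : Q.colouredMap.Dart} (h : Below e x) (k : Q.next y.1 = Q.rev e.1) :
    Below y x := by
  have hr : Q.rot.symm (Q.rev e.1) = Q.rev y.1 := by
    rw [← k, ← rot_rev, Equiv.symm_apply_apply]
  have := h.of_step (by rw [hr]; exact not_coloured_rev y.2)
  rwa [hr] at this

theorem below_back {y : Q.colouredMap.Dart} (h : Q.label (Q.colouredMap.rev y).1 < Q.label y.1) :
    Below y (Q.colouredMap.back y) := by
  have h1 := (firstHit_colouredMap_rot (Q.colouredMap.back y)).symm (Q.colouredMap.back y).2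
  rw [LabeledMap.rot_back, ← (simpleTop_of_lt h).2] at h1
  have hr : Q.rot.symm (Q.next y.1) = Q.rev y.1 := by rw [← rot_rev, Equiv.symm_apply_apply]
  have := h1.of_step (by rw [hr]; exact not_coloured_rev y.2)
  rwa [hr] at this

theorem label_le_of_chain {y z : Q.colouredMap.Dart} (h : Relation.ReflTransGen Below y z) :
    Q.label z.1 ≤ Q.label y.1 := by
  induction h with
  | refl => exact le_rfl
  | tail _ h ih => have := h.label; omega

/-- Following the contour of a face of the coloured map down to a given level amounts to descending
along the edges of the quadrangulation. -/
theorem chain_of_firstHit {t : ℤ} {y z : Q.colouredMap.Dart}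
    (h : FirstHit Q.colouredMap.back (fun e => Q.label e.1 < t) y z) (hy : t ≤ Q.label y.1) :
    Relation.ReflTransGen Below y z := by
  have hlab : ∀ y, Q.label (Q.colouredMap.back y).1 = Q.label (Q.colouredMap.rev y).1 :=
    Q.colouredMap.label_back
  induction h with
  | @hit y h =>
    exact .single (below_back (by rw [← hlab]; omega))
  | @step y z h k ih =>
    have hz : Q.label z.1 < t := k.holds
    -- A descent from `w` to `z` has at least one step, since `w` is at level `t` or above and `z`
    -- is below; its first step can then be taken from `y`.
    have head : ∀ w : Q.colouredMap.Dart, t ≤ Q.label w.1 → Relation.ReflTransGen Below w z →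
        (∀ x, Below w x → Below y x) → Relation.ReflTransGen Below y z := by
      intro w hw hc hb
      rcases hc.cases_head with rfl | ⟨x, hx, hc⟩
      · omega
      · exact .head (hb x hx) hc
    have ih := ih (not_lt.1 h)
    rcases lt_trichotomy (Q.label (Q.colouredMap.rev y).1) (Q.label y.1) with k | k | k
    · exact .head (below_back k) ih
    · exact head _ (not_lt.1 h) ih fun x hx => hx.of_next (next_of_confluent k)
    -- Along a rising edge the descent from `back y` must pass through `x`, which has the same
    -- vertex below it as `y`; the detour by `back y` is removed.
    · obtain ⟨x, hx1, hx2⟩ := exists_next_of_mid k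
      have hxl := (below_of_rot hx2).label
      rw [hlab] at hxl
      refine head x (by omega) ?_ fun w hw => hw.of_next hx1
      rcases ih.cases_head with rfl | ⟨w, hw, hc⟩
      · exact absurd hz h
      · rwa [Subtype.ext (hw.unique (below_of_rot hx2))] at hc

/-- When the edge rises, the descent shadowing the contour from `back d` to `pred d` loses exactly
one unit, so it is a single step, and that step leads to the dart `x` of `exists_next_of_mid`. -/
theorem next_of_level {d : Q.colouredMap.Dart}
    (h : Q.label d.1 ≤ Q.label (Q.colouredMap.rev d).1) :
    Q.next d.1 = Q.rev (Q.colouredMap.pred d).1 := by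
  have hM := Q.colouredMap_isGentle
  rcases h.lt_or_eq with k | k
  · obtain ⟨x, hx1, hx2⟩ := exists_next_of_mid k
    have hxl := (below_of_rot hx2).label
    have hlab : Q.label (Q.colouredMap.back d).1 = Q.label (Q.colouredMap.rev d).1 :=
      Q.colouredMap.label_back d
    have hp : Q.label (Q.colouredMap.pred d).1 = Q.label d.1 := hM.label_pred h
    have hl : Q.label (Q.colouredMap.rev d).1 ≤ Q.label d.1 + 1 := (hM.le d).2
    have hc : Relation.ReflTransGen Below (Q.colouredMap.back d) (Q.colouredMap.pred d) := by
      -- For integers, being below this level is being at most the label of `d`, the stopping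
      -- condition of `pred d`.
      refine chain_of_firstHit (t := Q.label d.1 + 1)
        (((Q.colouredMap.firstHit_pred d).of_step ?_).congr fun e => ?_) (by omega)
      · change ¬ Q.label (Q.colouredMap.back d).1 ≤ Q.label d.1
        omega
      · exact Int.lt_add_one_iff.symm
    rw [hx1]
    rcases hc.cases_head with e | ⟨w, hw, hc⟩
    · rw [← e] at hp
      omega
    · rw [Subtype.ext (hw.unique (below_of_rot hx2))] at hc
      rcases hc.cases_head with e | ⟨w, hw, hc⟩
      · rw [e]
      · have := hw.label
        have := label_le_of_chain hc
        omega
  · rw [Q.colouredMap.pred_of_le k.ge]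
    exact next_of_confluent k.symm

/-- The darts of a quadrangulation from the darts of its coloured map. -/
def unfold (Q : LabeledQuad) : Q.colouredMap.Dart × Bool → Q.Dart
  | (d, false) => d.1
  | (d, true) => Q.rev d.1

theorem unfold_bijective (Q : LabeledQuad) : Function.Bijective Q.unfold := by
  constructor
  · rintro ⟨d, _ | _⟩ ⟨e, _ | _⟩ h
    · rw [Subtype.ext h]
    · exact absurd d.2 (by rw [show d.1 = Q.rev e.1 from h]; exact not_coloured_rev e.2)
    · exact absurd e.2 (by rw [← show Q.rev d.1 = e.1 from h]; exact not_coloured_rev d.2)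
    · rw [Subtype.ext (Q.rev.injective h)]
  · intro d
    by_cases h : ∃ c', Q.Coloured d c'
    · exact ⟨(⟨d, h⟩, false), rfl⟩
    · exact ⟨(⟨Q.rev d, coloured_rev h⟩, true), Q.rev_rev d⟩

theorem unfold_flip (z : Q.colouredMap.Dart × Bool) :
    Q.unfold (Q.colouredMap.flip z) = Q.rev (Q.unfold z) := by
  rcases z with ⟨d, _ | _⟩
  · rfl
  · exact (Q.rev_rev d.1).symm

theorem unfold_stepFun (z : Q.colouredMap.Dart × Bool) :
    Q.unfold (Q.colouredMap.stepFun z) = Q.next (Q.unfold z) := by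
  have hM := Q.colouredMap_isGentle
  rcases z with ⟨d, _ | _⟩
  · rcases lt_or_ge (Q.label (Q.colouredMap.rev d).1) (Q.label d.1) with h | h
    · rw [LabeledMap.stepFun_desc (M := Q.colouredMap) h]
      exact (simpleTop_of_lt h).2.symm
    · rw [LabeledMap.stepFun_level (M := Q.colouredMap) h]
      exact (next_of_level h).symm
  · change _ = Q.next (Q.rev d.1)
    rw [next_rev]
    rcases le_or_gt (Q.colouredMap.label (Q.colouredMap.rev (Q.colouredMap.rot d)))
      (Q.colouredMap.label d) with h | h
    · rw [LabeledMap.stepFun_top h]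
      rw [← Q.colouredMap.label_rot d] at h
      have := rot_symm_of_top (c := Q.colouredMap.rot d) h
      rw [Equiv.symm_apply_apply] at this
      exact this.symm
    · rw [LabeledMap.stepFun_up h]
      obtain ⟨h1, h2⟩ := hM.label_succ h
      have k : Q.label (Q.colouredMap.succ d).1 <
          Q.label (Q.colouredMap.rev (Q.colouredMap.succ d)).1 := by
        change Q.colouredMap.label _ < Q.colouredMap.label _
        omega
      -- The face is read from its middle corner `succ d`, whose next side is the reversal of `d`.
      have h3 := next_next_of_mid k
      rw [next_of_level k.le, Q.colouredMap.pred_succ h1, next_rev] at h3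
      exact h3.symm

/-- A quadrangulation is recovered from its coloured map. -/
theorem exists_isIso_quadrangulate (Q : LabeledQuad) :
    ∃ f : (Q.colouredMap.quadrangulate Q.colouredMap_isGentle).Dart ≃ Q.Dart,
      LabeledMap.IsIso (Q.colouredMap.quadrangulate Q.colouredMap_isGentle) Q.toLabeledMap f ∧
      f (Q.colouredMap.quadrangulate Q.colouredMap_isGentle).root = Q.topRoot := by
  refine ⟨Equiv.ofBijective Q.unfold Q.unfold_bijective, ⟨fun z => ?_, unfold_flip, ?_⟩, ?_⟩
  · exact (unfold_stepFun (Q.colouredMap.flip z)).trans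
      ((congrArg Q.next (unfold_flip z)).trans (next_rev _))
  · rintro ⟨d, _ | _⟩
    · rfl
    · have h1 := exists_coloured_iff.1 d.2
      have h2 := label_rev_eq d.1
      change Q.label (Q.rev d.1) = Q.label d.1 - 1
      omega
  · have e : Q.colouredMap.back Q.colouredMap.root = Q.topColoured := by
      refine Q.colouredMap.rot.injective ?_
      rw [LabeledMap.rot_back]
      exact Q.otherEnd_otherEnd _
    exact congrArg Subtype.val e

end LabeledQuad

/-! ### Invariance under isomorphism. -/

theorem Equiv.Perm.SameCycle.map_of_semiconj {X Y : Type} [Finite X] {s : Equiv.Perm X}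
    {s' : Equiv.Perm Y} {f : X → Y} (hs : ∀ a, f (s a) = s' (f a)) {a b : X}
    (h : s.SameCycle a b) : s'.SameCycle (f a) (f b) := by
  obtain ⟨n, -, rfl⟩ := h.exists_pow_eq'
  clear h
  induction n with
  | zero => exact Equiv.Perm.SameCycle.refl _ _
  | succ k ih =>
    rw [pow_succ', Equiv.Perm.mul_apply, hs]
    exact ih.apply_right

/-- A conjugation of permutations identifies their sets of cycles. -/
def cyclesCongr {X Y : Type} [Finite X] [Finite Y] {s : Equiv.Perm X} {s' : Equiv.Perm Y}
    (f : X ≃ Y) (hs : ∀ a, f (s a) = s' (f a)) :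
    Quotient (Equiv.Perm.SameCycle.setoid s) ≃ Quotient (Equiv.Perm.SameCycle.setoid s') :=
  Quotient.congr f fun a b =>
    ⟨fun h => Equiv.Perm.SameCycle.map_of_semiconj hs h, fun h => by
      have := Equiv.Perm.SameCycle.map_of_semiconj (f := f.symm)
        (fun a => by rw [Equiv.symm_apply_eq, hs, Equiv.apply_symm_apply]) h
      rwa [f.symm_apply_apply, f.symm_apply_apply] at this⟩

namespace LabeledMap.IsIso

variable {M N : LabeledMap} {f : M.Dart ≃ N.Dart}

theorem card_edge (h : LabeledMap.IsIso M N f) : Nat.card M.Edge = Nat.card N.Edge :=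
  Nat.card_congr (cyclesCongr f h.map_rev)

theorem map_next (h : LabeledMap.IsIso M N f) (d : M.Dart) : f (M.next d) = N.next (f d) :=
  (h.map_rot _).trans (congrArg N.rot (h.map_rev d))

theorem card_face (h : LabeledMap.IsIso M N f) : Nat.card M.Face = Nat.card N.Face :=
  Nat.card_congr (cyclesCongr f h.map_next)

/-- The bijection between vertices induced by an isomorphism. -/
def vertexEquiv (h : LabeledMap.IsIso M N f) : M.Vertex ≃ N.Vertex := cyclesCongr f h.map_rot

theorem vertexEquiv_start (h : LabeledMap.IsIso M N f) (d : M.Dart) : h.vertexEquiv (M.start d) = N.start (f d) := rfl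

theorem vertexLabel_vertexEquiv (h : LabeledMap.IsIso M N f) (v : M.Vertex) :
    N.vertexLabel (h.vertexEquiv v) = M.vertexLabel v := by
  obtain ⟨d, rfl⟩ := Quotient.exists_rep v
  exact h.map_label d

theorem range_vertexLabel (h : LabeledMap.IsIso M N f) : Set.range M.vertexLabel = Set.range N.vertexLabel := by
  rw [← h.vertexEquiv.surjective.range_comp N.vertexLabel]
  exact congrArg Set.range (funext fun v => (h.vertexLabel_vertexEquiv v).symm)

/-- The relation `r` is left free to serve local minima and local maxima alike. -/
theorem forall_neighbor_iff (h : LabeledMap.IsIso M N f) (r : ℤ → ℤ → Prop) (v : M.Vertex) :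
    (∀ d, M.start d = v → r (M.vertexLabel v) (M.vertexLabel (M.start (M.rev d)))) ↔
      ∀ d, N.start d = h.vertexEquiv v →
        r (N.vertexLabel (h.vertexEquiv v)) (N.vertexLabel (N.start (N.rev d))) := by
  rw [← f.forall_congr_right]
  refine forall_congr' fun d => ?_
  rw [← h.vertexEquiv_start, h.vertexEquiv.apply_eq_iff_eq, h.vertexLabel_vertexEquiv,
    ← h.map_rev, ← h.vertexEquiv_start, h.vertexLabel_vertexEquiv]

theorem card_localMin (h : LabeledMap.IsIso M N f) :
    Nat.card {v // M.IsLocalMin v} = Nat.card {v // N.IsLocalMin v} :=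
  Nat.card_congr (h.vertexEquiv.subtypeEquiv fun v => h.forall_neighbor_iff (· ≤ ·) v)

theorem card_localMax (h : LabeledMap.IsIso M N f) :
    Nat.card {v // M.IsLocalMax v} = Nat.card {v // N.IsLocalMax v} :=
  Nat.card_congr (h.vertexEquiv.subtypeEquiv fun v => h.forall_neighbor_iff (· ≥ ·) v)

theorem isPlanarMap (h : LabeledMap.IsIso M N f) (hM : M.IsPlanarMap) : N.IsPlanarMap := by
  refine ⟨fun d e => ?_, ?_⟩
  · have := CombMap.rel_of_joined (M := M.toCombMap)
      (r := fun d e => N.Joined (f d) (f e)) ⟨fun _ => .refl _, .symm, .trans⟩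
      (fun d => by rw [h.map_rot]; exact CombMap.joined_rot _)
      (fun d => by rw [h.map_rev]; exact CombMap.joined_rev _) (hM.1 (f.symm d) (f.symm e))
    rwa [f.apply_symm_apply, f.apply_symm_apply] at this
  · rw [← h.card_edge, ← h.card_face, ← Nat.card_congr h.vertexEquiv, hM.2]

theorem map_back (h : LabeledMap.IsIso M N f) (d : M.Dart) : f (M.back d) = N.back (f d) := by
  refine N.rot.injective ?_
  rw [← h.map_rot, rot_back, rot_back, h.map_rev]

theorem map_back_symm (h : LabeledMap.IsIso M N f) (d : M.Dart) : f (M.back.symm d) = N.back.symm (f d) := by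
  rw [back_symm_apply, back_symm_apply, h.map_rev, h.map_rot]

theorem map_pred (h : LabeledMap.IsIso M N f) (d : M.Dart) : f (M.pred d) = N.pred (f d) :=
  ((M.firstHit_pred d).map (p' := fun e => N.label e ≤ N.label (f d)) f h.map_back
    fun a => by rw [h.map_label, h.map_label]).unique (N.firstHit_pred _)

theorem map_succ (h : LabeledMap.IsIso M N f) (d : M.Dart) : f (M.succ d) = N.succ (f d) :=
  ((M.firstHit_succ d).map (p' := fun e => N.label e ≤ N.label (f d)) f h.map_back_symm
    fun a => by rw [h.map_label, h.map_label]).unique (N.firstHit_succ _)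

theorem map_stepFun (h : LabeledMap.IsIso M N f) (z : M.Dart × Bool) :
    Prod.map f id (M.stepFun z) = N.stepFun (Prod.map f id z) := by
  rcases z with ⟨d, _ | _⟩
  · simp only [stepFun, Prod.map_apply, id, ← h.map_rev, h.map_label, ← h.map_pred]
    split_ifs <;> rfl
  · simp only [stepFun, Prod.map_apply, id, ← h.map_rev, ← h.map_rot, h.map_label, ← h.map_succ,
      ← h.map_back]
    split_ifs <;> rfl

theorem exists_quadrangulate (h : LabeledMap.IsIso M N f) (hM : M.IsGentle) (hN : N.IsGentle) (hr : f M.root = N.root) :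
    ∃ g : (M.quadrangulate hM).Dart ≃ (N.quadrangulate hN).Dart,
      LabeledMap.IsIso (M.quadrangulate hM) (N.quadrangulate hN) g ∧
        g (M.quadrangulate hM).root = (N.quadrangulate hN).root := by
  refine ⟨f.prodCongr (Equiv.refl Bool), ⟨fun z => h.map_stepFun _, fun z => rfl, ?_⟩, ?_⟩
  · rintro ⟨d, _ | _⟩
    · exact h.map_label d
    · exact congrArg (· - 1) (h.map_label d)
  · exact Prod.ext ((h.map_back _).trans (congrArg N.back hr)) rfl

end LabeledMap.IsIso

/-! ### Schaeffer's map on equivalence classes. -/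

namespace LabeledQuad

variable {P Q : LabeledQuad} {f : P.Dart ≃ Q.Dart}

theorem coloured_map (h : LabeledMap.IsIso P.toLabeledMap Q.toLabeledMap f) (c c' : P.Dart) :
    Q.Coloured (f c) (f c') ↔ P.Coloured c c' := by
  simp only [Coloured, SimpleTop, ConfluentTop, ← h.map_next, h.map_label,
    f.apply_eq_iff_eq]

theorem exists_coloured_map (h : LabeledMap.IsIso P.toLabeledMap Q.toLabeledMap f) (c : P.Dart) :
    (∃ c', P.Coloured c c') ↔ ∃ c', Q.Coloured (f c) c' := by
  rw [← f.exists_congr_right]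
  simp only [coloured_map h]

/-- The bijection between coloured darts induced by an isomorphism. -/
def colouredCongr (h : LabeledMap.IsIso P.toLabeledMap Q.toLabeledMap f) :
    P.ColouredDart ≃ Q.ColouredDart :=
  f.subtypeEquiv (exists_coloured_map h)

theorem isIso_colouredCongr (h : LabeledMap.IsIso P.toLabeledMap Q.toLabeledMap f) :
    LabeledMap.IsIso P.colouredMap Q.colouredMap (colouredCongr h) where
  map_rot c := Subtype.ext
    (((firstHit_colouredMap_rot c).map f h.map_rot (exists_coloured_map h)).unique
      (firstHit_colouredMap_rot (colouredCongr h c)))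
  map_rev c := (otherEnd_eq (c := colouredCongr h c) (c' := colouredCongr h (P.otherEnd c))
    ((coloured_map h _ _).2 (coloured_otherEnd c))).symm
  map_label c := h.map_label c.1

theorem topRoot_map (h : LabeledMap.IsIso P.toLabeledMap Q.toLabeledMap f)
    (hr : f P.root = Q.root ∨ f P.root = Q.rev Q.root) : f P.topRoot = Q.topRoot := by
  have h1 := label_rev_eq P.root
  unfold topRoot
  rcases hr with hr | hr
  · rw [← hr, ← h.map_rev, h.map_label, h.map_label, apply_ite f]
  · have hr' : Q.root = f (P.rev P.root) := by rw [h.map_rev, hr, Q.rev_rev]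
    rw [hr', ← h.map_rev, P.rev_rev, h.map_label, h.map_label, apply_ite f]
    -- With the marked dart reversed, the branches disagree only if the two labels are equal, which
    -- `h1` excludes.
    split_ifs <;> first | rfl | omega

theorem colouredCongr_root (h : LabeledMap.IsIso P.toLabeledMap Q.toLabeledMap f)
    (hr : f P.root = Q.root ∨ f P.root = Q.rev Q.root) :
    colouredCongr h P.colouredMap.root = Q.colouredMap.root := by
  have e : colouredCongr h P.topColoured = Q.topColoured := Subtype.ext (topRoot_map h hr)
  have hi := isIso_colouredCongr h
  refine (hi.map_rev (P.colouredMap.rot P.topColoured)).trans ?_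
  refine (congrArg Q.colouredMap.rev (hi.map_rot P.topColoured)).trans ?_
  exact congrArg (fun c => Q.colouredMap.rev (Q.colouredMap.rot c)) e

theorem topRoot_eq_or (Q : LabeledQuad) : Q.topRoot = Q.root ∨ Q.topRoot = Q.rev Q.root := by
  unfold topRoot
  split_ifs
  · exact Or.inl rfl
  · exact Or.inr rfl

/-- The dart `topRoot` determines the marked dart up to reversal, which is all that an unoriented
root edge records. -/
theorem equiv_of_topRoot (h : LabeledMap.IsIso P.toLabeledMap Q.toLabeledMap f)
    (ht : f P.topRoot = Q.topRoot) : P ≈ Q := by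
  refine ⟨f, h, ?_⟩
  rcases P.topRoot_eq_or with hP | hP
  · rw [hP] at ht
    rw [ht]
    exact Q.topRoot_eq_or
  · rw [hP, h.map_rev] at ht
    have ht' := congrArg Q.rev ht
    rw [Q.rev_rev] at ht'
    rw [ht']
    rcases Q.topRoot_eq_or with hQ | hQ <;> rw [hQ]
    · exact Or.inr rfl
    · exact Or.inl (Q.rev_rev _)

theorem label_topRoot (Q : LabeledQuad) :
    Q.label Q.topRoot = max (Q.label Q.root) (Q.label (Q.rev Q.root)) := by
  unfold topRoot
  split_ifs with h
  · exact (max_eq_left h.le).symm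
  · exact (max_eq_right (not_lt.1 h)).symm

/-- The coloured map as a labeled planar map. -/
noncomputable def toPlanarMap (Q : LabeledQuad) : LabeledPlanarMap where
  toLabeledMap := Q.colouredMap
  planar := by
    obtain ⟨f, hf, -⟩ := Q.exists_isIso_quadrangulate
    -- Connectedness of the coloured graph is obtained here: `Q` is isomorphic to the
    -- quadrangulation built from it.
    exact Q.colouredMap_isGentle.isPlanarMap_quadrangulate.1 (hf.symm.isPlanarMap Q.planar)
  label_rev := Q.colouredMap_isGentle

/-- Schaeffer's map from labeled quadrangulations to labeled planar maps. -/
noncomputable def schaeffer : LabeledQuadClass → LabeledPlanarMapClass :=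
  Quotient.map toPlanarMap fun _ _ ⟨_, h, hr⟩ =>
    ⟨colouredCongr h, isIso_colouredCongr h, colouredCongr_root h hr⟩

theorem schaeffer_injective : Function.Injective schaeffer := by
  intro x y
  induction x using Quotient.inductionOn with | _ P => ?_
  induction y using Quotient.inductionOn with | _ Q => ?_
  intro hPQ
  obtain ⟨g, hg, hgr⟩ : ∃ g : P.colouredMap.Dart ≃ Q.colouredMap.Dart,
      LabeledMap.IsIso P.colouredMap Q.colouredMap g ∧
        g P.colouredMap.root = Q.colouredMap.root := Quotient.exact hPQ
  obtain ⟨f, hf, hfr⟩ := P.exists_isIso_quadrangulate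
  obtain ⟨k, hk, hkr⟩ := Q.exists_isIso_quadrangulate
  obtain ⟨m, hm, hmr⟩ :=
    hg.exists_quadrangulate P.colouredMap_isGentle Q.colouredMap_isGentle hgr
  refine Quotient.sound (equiv_of_topRoot ((hf.symm.trans hm).trans hk) ?_)
  rw [← hfr, ← hkr, ← hmr]
  simp only [Equiv.trans_apply, Equiv.symm_apply_apply]

theorem schaeffer_surjective : Function.Surjective schaeffer := by
  intro x
  induction x using Quotient.inductionOn with | _ M => ?_
  exact ⟨Quotient.mk _ M.toQuad, Quotient.sound
    (Setoid.symm ⟨M.colouredEquiv, M.isIso_colouredEquiv, M.colouredEquiv_root⟩)⟩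

end LabeledQuad

theorem theorem1 :
    ∃ Ψ : LabeledQuadClass → LabeledPlanarMapClass,
      (∀ Q : LabeledQuad, ∃ M : LabeledPlanarMap,
        M.toLabeledMap = Q.colouredMap ∧ Ψ (Quotient.mk _ Q) = Quotient.mk _ M) ∧
      Function.Bijective Ψ ∧
      ∀ (Q : LabeledQuad) (M : LabeledPlanarMap), Ψ (Quotient.mk _ Q) = Quotient.mk _ M →
        Nat.card M.Edge = Nat.card Q.Face ∧
        Nat.card M.Face = Nat.card {v : Q.Vertex // Q.IsLocalMin v} ∧
        Nat.card {v : M.Vertex // M.IsLocalMax v} = Nat.card {v : Q.Vertex // Q.IsLocalMax v} ∧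
        (∃ t : ℤ, IsGreatest (Set.range Q.vertexLabel) t ∧
          IsGreatest (Set.range M.vertexLabel) t) ∧
        (∃ t : ℤ, IsLeast (Set.range Q.vertexLabel) t ∧
          IsLeast (Set.range M.vertexLabel) (t + 1)) ∧
        M.label (M.rev M.root) = max (Q.label Q.root) (Q.label (Q.rev Q.root)) := by
  refine ⟨LabeledQuad.schaeffer, fun Q => ⟨Q.toPlanarMap, rfl, rfl⟩,
    ⟨LabeledQuad.schaeffer_injective, LabeledQuad.schaeffer_surjective⟩, fun Q M hQM => ?_⟩
  obtain ⟨g, hg, hgr⟩ : ∃ g : Q.colouredMap.Dart ≃ M.Dart,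
      LabeledMap.IsIso Q.colouredMap M.toLabeledMap g ∧
        g Q.colouredMap.root = M.root := Quotient.exact hQM
  obtain ⟨f, hf, -⟩ := Q.exists_isIso_quadrangulate
  have hC := Q.colouredMap_isGentle
  refine ⟨?_, ?_, ?_, ?_, ?_, ?_⟩
  · rw [← hg.card_edge, ← hf.card_face, hC.card_edge.1]
  · rw [← hg.card_face, ← hf.card_localMin, hC.card_face]
  · rw [← hg.card_localMax, ← hf.card_localMax, hC.card_localMax]
  · rw [← hg.range_vertexLabel, ← hf.range_vertexLabel]
    exact hC.exists_greatest
  · rw [← hg.range_vertexLabel, ← hf.range_vertexLabel]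
    exact hC.exists_least
  · rw [← hgr, ← hg.map_rev, hg.map_label, ← Q.label_topRoot]
    -- The root edge ends where the coloured dart following `topColoured` starts, that is, at the
    -- starting vertex of `topRoot`.
    have e : Q.colouredMap.rev Q.colouredMap.root = Q.colouredMap.rot Q.topColoured :=
      Q.otherEnd_otherEnd _
    rw [e]
    exact Q.colouredMap.label_rot _
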